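/- Let $n<d$, let $\mathcal X\subseteq\mathbb R^d$ be open, and let $h:\mathcal X\to\mathbb R^n$ be a twice continuously differentiable submersion, i.e. its differential is surjective at every $x\in\mathcal X$; write $\nabla h(x)$ for the $n\times d$ Jacobian matrix. Let $\mathcal M=\{x\in\mathcal X: h(x)=0\}$, which is a $C^2$ submanifold of $\mathcal X$ of dimension $d-n$, and let $\lambda_{\mathcal M}$ be its Riemannian measure, for the metric induced by the Euclidean metric of $\mathbb R^d$ (regarded as a Borel measure on $\mathcal X$ carried by $\mathcal M$). For $\varepsilon>0$ put $\mathcal M^\varepsilon=\{x\in\mathcal X:\|h(x)\|\le\varepsilon\}$, where $\|\cdot\|$ is the Euclidean norm. Let $a:\mathcal X\to[0,\infty)$ be continuous, and suppose that $$\lambda_{\mathcal M}\big(\{x\in\mathcal M: a(x)>0\}\big)>0\quad\text{and}\quad 0<\int_{\mathcal M^\varepsilon}a(x)\,dx<\infty\ \text{ for all }\varepsilon>0.$$ For $\varepsilon>0$ let $P_\varepsilon$ be the probability measure on $\mathcal X$ with Lebesgue density $a(x)\,\mathbb I_{\mathcal M^\varepsilon}(x)\big/\int_{\mathcal M^\varepsilon}a(w)\,dw$,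 and suppose that the family $\{P_\varepsilon:\varepsilon>0\}$ is tight on $\mathcal X$: for every $\delta>0$ there is a compact set $K\subseteq\mathcal X$ with $P_\varepsilon(\mathcal X\setminus K)\le\delta$ for all $\varepsilon>0$. Then $$0<\int_{\mathcal M}a(w)\det\big(\nabla h(w)\nabla h(w)^\top\big)^{-1/2}\lambda_{\mathcal M}(dw)<\infty,$$ and, as $\varepsilon\downarrow0$, $P_\varepsilon$ converges weakly on $\mathcal X$ to the probability measure $P_0$, carried by $\mathcal M$, that has the density $$f(x)=\frac{a(x)\det\big(\nabla h(x)\nabla h(x)^\top\big)^{-1/2}}{\int_{\mathcal M}a(w)\det\big(\nabla h(w)\nabla h(w)^\top\big)^{-1/2}\lambda_{\mathcal M}(dw)},\qquad x\in\mathcal M,$$ with respect to $\lambda_{\mathcal M}$. -/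

import Mathlib

open MeasureTheory Filter Topology
open scoped ENNReal BoundedContinuousFunction

/-- The Jacobian matrix `∇f(x)`, with entries `∂f_i/∂x_j`. -/
noncomputable def jacobian {p q : ℕ}
    (f : EuclideanSpace ℝ (Fin p) → EuclideanSpace ℝ (Fin q)) (x : EuclideanSpace ℝ (Fin p)) :
    Matrix (Fin q) (Fin p) ℝ :=
  Matrix.of fun i j => fderiv ℝ f x (EuclideanSpace.single j 1) i

/-- `φ`, restricted to the open set `U ⊆ ℝᵏ`, is a local parametrization (an inverse chart) of
`M ⊆ ℝᵈ` as a `k`-dimensional `C²` submanifold: a `C²` immersion that is a homeomorphism of `U`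
onto a relatively open subset of `M`. -/
structure IsLocalParam {k d : ℕ} (M : Set (EuclideanSpace ℝ (Fin d)))
    (U : Set (EuclideanSpace ℝ (Fin k)))
    (φ : EuclideanSpace ℝ (Fin k) → EuclideanSpace ℝ (Fin d)) : Prop where
  isOpen : IsOpen U
  contDiffOn : ContDiffOn ℝ 2 φ U
  injOn : Set.InjOn φ U
  immersion : ∀ u ∈ U, Function.Injective (fderiv ℝ φ u)
  /-- `φ` maps open subsets of `U` to relatively open subsets of `M`. -/
  image_open : ∀ V ⊆ U, IsOpen V → ∃ W, IsOpen W ∧ φ '' V = W ∩ M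

/-- The Riemannian measure in one chart, as a measure on `ℝᵈ`: the image under `φ` of
`√(det g(u)) du` on `U`, where `g(u) = ∇φ(u)ᵀ ∇φ(u)` is the metric induced by the Euclidean one. -/
noncomputable def chartMeasure {k d : ℕ} (U : Set (EuclideanSpace ℝ (Fin k)))
    (φ : EuclideanSpace ℝ (Fin k) → EuclideanSpace ℝ (Fin d)) :
    Measure (EuclideanSpace ℝ (Fin d)) :=
  ((volume.restrict U).withDensity fun u =>
    ENNReal.ofReal (Real.sqrt ((jacobian φ u).transpose * jacobian φ u).det)).map φ

/-- The Riemannian measure `λ_M` of a `k`-dimensional embedded `C²` submanifold `M` of `ℝᵈ` (with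
the metric induced by the Euclidean one), as a Borel measure on `ℝᵈ` carried by `M`.
It is obtained by gluing the chart measures: these agree on overlaps of charts, by the change of
variables formula, so the measure that restricts to the chart measure on the image of every chart
is the least measure that dominates all of them. -/
noncomputable def riemannianMeasure (k : ℕ) {d : ℕ} (M : Set (EuclideanSpace ℝ (Fin d))) :
    Measure (EuclideanSpace ℝ (Fin d)) :=
  ⨆ (U : Set (EuclideanSpace ℝ (Fin k)))
    (φ : EuclideanSpace ℝ (Fin k) → EuclideanSpace ℝ (Fin d)) (_ : IsLocalParam M U φ),
    chartMeasure U φ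

/-- The level set `M = {x ∈ X : h(x) = 0}`. -/
def levelSet {d n : ℕ} (X : Set (EuclideanSpace ℝ (Fin d)))
    (h : EuclideanSpace ℝ (Fin d) → EuclideanSpace ℝ (Fin n)) : Set (EuclideanSpace ℝ (Fin d)) :=
  {x | x ∈ X ∧ h x = 0}

/-- The `ε`-fattening `M^ε = {x ∈ X : ‖h(x)‖ ≤ ε}`. -/
def fattening {d n : ℕ} (X : Set (EuclideanSpace ℝ (Fin d)))
    (h : EuclideanSpace ℝ (Fin d) → EuclideanSpace ℝ (Fin n)) (ε : ℝ) :
    Set (EuclideanSpace ℝ (Fin d)) :=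
  {x | x ∈ X ∧ ‖h x‖ ≤ ε}

/-- `∫_{M^ε} a(x) dx`. -/
noncomputable def fatteningMass {d n : ℕ} (X : Set (EuclideanSpace ℝ (Fin d)))
    (h : EuclideanSpace ℝ (Fin d) → EuclideanSpace ℝ (Fin n))
    (a : EuclideanSpace ℝ (Fin d) → ℝ) (ε : ℝ) : ℝ≥0∞ :=
  ∫⁻ x in fattening X h ε, ENNReal.ofReal (a x)

/-- `P_ε`, a measure on the space `X`: the law with Lebesgue density
`a(x) 𝟙_{M^ε}(x) / ∫_{M^ε} a`. -/
noncomputable def truncatedLaw {d n : ℕ} (X : Set (EuclideanSpace ℝ (Fin d)))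
    (h : EuclideanSpace ℝ (Fin d) → EuclideanSpace ℝ (Fin n))
    (a : EuclideanSpace ℝ (Fin d) → ℝ) (ε : ℝ) : Measure X :=
  (volume.withDensity fun x =>
    (fattening X h ε).indicator (fun y => ENNReal.ofReal (a y)) x / fatteningMass X h a ε).comap
      Subtype.val

/-- `a(x) det(∇h(x) ∇h(x)ᵀ)^{-1/2}`. -/
noncomputable def limitWeight {d n : ℕ}
    (h : EuclideanSpace ℝ (Fin d) → EuclideanSpace ℝ (Fin n))
    (a : EuclideanSpace ℝ (Fin d) → ℝ) (x : EuclideanSpace ℝ (Fin d)) : ℝ≥0∞ :=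
  ENNReal.ofReal
    (a x * (jacobian h x * (jacobian h x).transpose).det ^ (-(1 / 2) : ℝ))

/-- `∫_M a(w) det(∇h(w) ∇h(w)ᵀ)^{-1/2} λ_M(dw)`. -/
noncomputable def limitMass {d n : ℕ} (X : Set (EuclideanSpace ℝ (Fin d)))
    (h : EuclideanSpace ℝ (Fin d) → EuclideanSpace ℝ (Fin n))
    (a : EuclideanSpace ℝ (Fin d) → ℝ) : ℝ≥0∞ :=
  ∫⁻ w in levelSet X h, limitWeight h a w ∂(riemannianMeasure (d - n) (levelSet X h))

/-- `P_0`, a measure on the space `X` (carried by `M`): the law whose density with respect to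
`λ_M` is `limitWeight` divided by its integral over `M`. -/
noncomputable def limitLaw {d n : ℕ} (X : Set (EuclideanSpace ℝ (Fin d)))
    (h : EuclideanSpace ℝ (Fin d) → EuclideanSpace ℝ (Fin n))
    (a : EuclideanSpace ℝ (Fin d) → ℝ) : Measure X :=
  ((riemannianMeasure (d - n) (levelSet X h)).withDensity fun x =>
    limitWeight h a x / limitMass X h a).comap Subtype.val

/-! Near a point of the zero set `M` the submersion can be straightened: with `k = d - n`, there is
a `C²` diffeomorphism `G` from an open subset of `ℝᵏ × ℝⁿ` with `h (G (u, y)) = y`. In these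
coordinates the fattening is the tube `‖y‖ ≤ ε`. For `g` supported in `G.target`, a change of
variables turns the integral of `g` over the fattening, divided by the volume of the `ε`-ball, into
an average over thin tubes, which tends to the integral of `|det DG(u, 0)| g(G(u, 0))` over `u`.
Differentiating `h ∘ G = snd` and some linear algebra (`abs_det_splitCoords_comp`) factor this
determinant as the Riemannian density of the chart `u ↦ G (u, 0)` times `det (∇h ∇hᵀ)^{-1/2}`.

The integrals over the fattenings do not involve `G`. By uniqueness of limits, the chart measures of
two straightenings agree on overlaps (`IsStraightening.chartMeasure_congr`). Every local
parametrization extends locally to a straightening, so the supremum `riemannianMeasure` is the chart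
measure on each `G.target`, and a partition of unity gives the limit formula for all continuous `g`
compactly supported in `X` (`tendsto_fattening_integral`).

Tightness is uniform in `ε`, so a compactly supported cutoff loses only a small fraction of the
mass. This bounds the normalized masses of `a`, makes the limit integral finite and extends the
formula to `b * a` with `b` bounded and continuous (`tendsto_fattening_integral_of_tight`). Dividing
the formula for `b * a` by that for `a` cancels the ball volumes. The limiting denominator is
positive because the weight is positive on `M` and `a` is positive on a set of positive
`λ_M`-measure. -/

/-! ### Splitting of coordinates and the determinant identity -/

/-- The splitting `ℝᵈ ≃ ℝᵏ × ℝⁿ` of the coordinates given by a bijection of the index sets. -/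
noncomputable def splitCoords {d k n : ℕ} (σ : Fin d ≃ Fin k ⊕ Fin n) :
    EuclideanSpace ℝ (Fin d) ≃L[ℝ] EuclideanSpace ℝ (Fin k) × EuclideanSpace ℝ (Fin n) :=
  (LinearIsometryEquiv.piLpCongrLeft 2 ℝ ℝ σ).toContinuousLinearEquiv.trans
    EuclideanSpace.sumEquivProd

lemma splitCoords_fst_apply {d k n : ℕ} (σ : Fin d ≃ Fin k ⊕ Fin n)
    (x : EuclideanSpace ℝ (Fin d)) (i : Fin k) : (splitCoords σ x).1 i = x (σ.symm (Sum.inl i)) := rfl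

lemma splitCoords_snd_apply {d k n : ℕ} (σ : Fin d ≃ Fin k ⊕ Fin n)
    (x : EuclideanSpace ℝ (Fin d)) (i : Fin n) : (splitCoords σ x).2 i = x (σ.symm (Sum.inr i)) := rfl

/-- The differential of a map `ℝᵏ × ℝⁿ → ℝᵈ` has no determinant of its own. Composing with this
volume-preserving map makes it an endomorphism and leaves integrals unchanged. -/
lemma splitCoords_measurePreserving {d k n : ℕ} (σ : Fin d ≃ Fin k ⊕ Fin n) :
    MeasurePreserving (splitCoords σ) := by
  have h1 := PiLp.volume_preserving_ofLp (Fin d)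
  have h2 := volume_measurePreserving_piCongrLeft (fun _ => ℝ) σ
  have h3 := volume_measurePreserving_sumPiEquivProdPi (fun _ : Fin k ⊕ Fin n => ℝ)
  have h4 := (PiLp.volume_preserving_toLp (Fin k)).prod (PiLp.volume_preserving_toLp (Fin n))
  have h5 := h4.comp (h3.comp (h2.comp h1))
  suffices h6 : ⇑(splitCoords σ) = Prod.map (WithLp.toLp 2) (WithLp.toLp 2) ∘
      ⇑(MeasurableEquiv.sumPiEquivProdPi fun _ : Fin k ⊕ Fin n => ℝ) ∘
      ⇑(MeasurableEquiv.piCongrLeft (fun _ => ℝ) σ) ∘ WithLp.ofLp by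
    rw [h6]; exact h5
  ext x i
  · simp [splitCoords_fst_apply, MeasurableEquiv.piCongrLeft, Equiv.piCongrLeft,
      Equiv.piCongrLeft', MeasurableEquiv.sumPiEquivProdPi, Equiv.sumPiEquivProdPi]
  · simp [splitCoords_snd_apply, MeasurableEquiv.piCongrLeft, Equiv.piCongrLeft,
      Equiv.piCongrLeft', MeasurableEquiv.sumPiEquivProdPi, Equiv.sumPiEquivProdPi]

/-- If `A P = 0` and `A B = 1`, then the square matrix `[P B]` satisfies
`det [P B]² · det (A Aᵀ) = det (Pᵀ P)`, provided that `det (Pᵀ P) ≠ 0`. -/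
lemma sq_det_fromCols_mul_det {d k n : ℕ} (σ : Fin d ≃ Fin k ⊕ Fin n)
    (P : Matrix (Fin d) (Fin k) ℝ) (B : Matrix (Fin d) (Fin n) ℝ) (A : Matrix (Fin n) (Fin d) ℝ)
    (hAP : A * P = 0) (hAB : A * B = 1) (hP : (P.transpose * P).det ≠ 0) :
    ((P.fromCols B).submatrix σ.symm id).det ^ 2 * (A * A.transpose).det
      = (P.transpose * P).det := by
  set T := (P.fromCols B).submatrix σ.symm id with hT
  -- `Q = [P Aᵀ]` completes `P` by vectors orthogonal to its columns, so `Qᵀ Q` is block diagonal,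
  -- while `Qᵀ [P B]` is block triangular with diagonal blocks `Pᵀ P` and `1`. Eliminating `det Q`
  -- from the two determinants gives the claim.
  set Q := (P.fromCols A.transpose).submatrix σ.symm id with hQ
  have hPA : P.transpose * A.transpose = 0 := by rw [← Matrix.transpose_mul, hAP]; simp
  have h1 : Q.transpose * Q = Matrix.fromBlocks (P.transpose * P) 0 0 (A * A.transpose) := by
    rw [hQ, Matrix.transpose_submatrix, Matrix.submatrix_mul_equiv, Matrix.transpose_fromCols,
      Matrix.fromRows_mul_fromCols]
    simp [hAP, hPA]
  have h2 : Q.transpose * T = Matrix.fromBlocks (P.transpose * P) (P.transpose * B) 0 1 := by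
    rw [hQ, Matrix.transpose_submatrix, hT, Matrix.submatrix_mul_equiv, Matrix.transpose_fromCols,
      Matrix.fromRows_mul_fromCols]
    simp [hAP, hAB]
  have d1 := congrArg Matrix.det h1
  have d2 := congrArg Matrix.det h2
  rw [Matrix.det_mul, Matrix.det_transpose, Matrix.det_fromBlocks_zero₂₁] at d1 d2
  rw [Matrix.det_one, mul_one] at d2
  apply mul_left_cancel₀ hP
  calc _ = T.det ^ 2 * ((P.transpose * P).det * (A * A.transpose).det) := by ring
    _ = (Q.det * T.det) ^ 2 := by rw [← d1]; ring
    _ = _ := by rw [d2]; ring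

/-- The matrix of a linear map between Euclidean spaces. -/
noncomputable def coordMatrix {p q : ℕ}
    (f : EuclideanSpace ℝ (Fin p) →L[ℝ] EuclideanSpace ℝ (Fin q)) : Matrix (Fin q) (Fin p) ℝ :=
  Matrix.of fun i j => f (EuclideanSpace.single j 1) i

lemma jacobian_eq_coordMatrix {p q : ℕ}
    (f : EuclideanSpace ℝ (Fin p) → EuclideanSpace ℝ (Fin q)) (x : EuclideanSpace ℝ (Fin p)) :
    jacobian f x = coordMatrix (fderiv ℝ f x) := rfl

lemma coordMatrix_eq_toMatrix {p q : ℕ}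
    (f : EuclideanSpace ℝ (Fin p) →L[ℝ] EuclideanSpace ℝ (Fin q)) :
    coordMatrix f = LinearMap.toMatrix (EuclideanSpace.basisFun (Fin p) ℝ).toBasis
      (EuclideanSpace.basisFun (Fin q) ℝ).toBasis f.toLinearMap := by
  ext i j
  simp [coordMatrix, LinearMap.toMatrix_apply]

lemma coordMatrix_comp {p q r : ℕ}
    (f : EuclideanSpace ℝ (Fin p) →L[ℝ] EuclideanSpace ℝ (Fin q))
    (g : EuclideanSpace ℝ (Fin q) →L[ℝ] EuclideanSpace ℝ (Fin r)) :
    coordMatrix (g ∘L f) = coordMatrix g * coordMatrix f := by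
  simp only [coordMatrix_eq_toMatrix]
  exact LinearMap.toMatrix_comp _ _ _ _ _

lemma coordMatrix_id {p : ℕ} :
    coordMatrix (ContinuousLinearMap.id ℝ (EuclideanSpace ℝ (Fin p))) = 1 := by
  simp only [coordMatrix_eq_toMatrix]
  exact LinearMap.toMatrix_id _

lemma coordMatrix_zero {p q : ℕ} :
    coordMatrix (0 : EuclideanSpace ℝ (Fin p) →L[ℝ] EuclideanSpace ℝ (Fin q)) = 0 := by
  ext i j; simp [coordMatrix]

lemma coordMatrix_mulVec {p q : ℕ}
    (f : EuclideanSpace ℝ (Fin p) →L[ℝ] EuclideanSpace ℝ (Fin q)) (x : EuclideanSpace ℝ (Fin p)) :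
    (coordMatrix f).mulVec x.ofLp = (f x).ofLp := by
  rw [coordMatrix_eq_toMatrix]
  exact LinearMap.toMatrix_mulVec_repr (EuclideanSpace.basisFun (Fin p) ℝ).toBasis
      (EuclideanSpace.basisFun (Fin q) ℝ).toBasis f.toLinearMap x

lemma det_coordMatrix_transpose_mul_self_pos {p q : ℕ}
    {f : EuclideanSpace ℝ (Fin p) →L[ℝ] EuclideanSpace ℝ (Fin q)} (hf : Function.Injective f) :
    0 < ((coordMatrix f).transpose * coordMatrix f).det := by
  have : (coordMatrix f).mulVec.Injective := by
    intro x y hxy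
    have := @hf (WithLp.toLp 2 x) (WithLp.toLp 2 y) (by
      ext i
      have := coordMatrix_mulVec f (WithLp.toLp 2 x)
      have h2 := coordMatrix_mulVec f (WithLp.toLp 2 y)
      simp only at this h2
      rw [← this, ← h2]; exact congrFun hxy i)
    exact congrArg WithLp.ofLp this
  exact (Matrix.PosDef.conjTranspose_mul_self _ this).det_pos

lemma det_coordMatrix_mul_transpose_pos {p q : ℕ}
    {f : EuclideanSpace ℝ (Fin p) →L[ℝ] EuclideanSpace ℝ (Fin q)} (hf : Function.Surjective f) :
    0 < (coordMatrix f * (coordMatrix f).transpose).det := by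
  have : (coordMatrix f).vecMul.Injective := by
    refine (injective_iff_map_eq_zero (Matrix.vecMulLinear (coordMatrix f))).2 fun y hy => ?_
    obtain ⟨x, hx⟩ := hf (WithLp.toLp 2 y)
    have h1 := coordMatrix_mulVec f x
    rw [hx] at h1
    rw [← dotProduct_self_eq_zero]
    nth_rewrite 2 [show y = (WithLp.toLp 2 y).ofLp from rfl]
    rw [← h1, Matrix.dotProduct_mulVec]
    rw [Matrix.vecMulLinear_apply] at hy
    rw [hy, zero_dotProduct]
  exact (Matrix.PosDef.mul_conjTranspose_self _ this).det_pos

lemma det_splitCoords_comp {d k n : ℕ} (σ : Fin d ≃ Fin k ⊕ Fin n)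
    (T : EuclideanSpace ℝ (Fin k) × EuclideanSpace ℝ (Fin n) →L[ℝ] EuclideanSpace ℝ (Fin d)) :
    ((splitCoords σ).toContinuousLinearMap ∘L T).det =
      (((coordMatrix (T ∘L ContinuousLinearMap.inl ℝ _ _)).fromCols
        (coordMatrix (T ∘L ContinuousLinearMap.inr ℝ _ _))).submatrix σ.symm id).det := by
  rw [ContinuousLinearMap.det, ← LinearMap.det_toMatrix
    ((EuclideanSpace.basisFun (Fin k) ℝ).toBasis.prod (EuclideanSpace.basisFun (Fin n) ℝ).toBasis)]
  congr 1
  ext i j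
  rw [LinearMap.toMatrix_apply]
  rcases i with i | i <;> rcases j with j | j <;>
  simp [coordMatrix, splitCoords_fst_apply, splitCoords_snd_apply]

/-- With `P` and `B` the matrices of `T` on the two factors, `A ∘ T = snd` says exactly that `A P =
0` and `A B = 1`. The identity for `det [P B]²` then applies, and a square root gives the formula.
-/
lemma abs_det_splitCoords_comp {d k n : ℕ} (σ : Fin d ≃ Fin k ⊕ Fin n)
    {T : EuclideanSpace ℝ (Fin k) × EuclideanSpace ℝ (Fin n) →L[ℝ] EuclideanSpace ℝ (Fin d)}
    (hT : Function.Injective T)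
    {A : EuclideanSpace ℝ (Fin d) →L[ℝ] EuclideanSpace ℝ (Fin n)}
    (hA : A ∘L T = ContinuousLinearMap.snd ℝ _ _) :
    |((splitCoords σ).toContinuousLinearMap ∘L T).det| =
      Real.sqrt ((coordMatrix (T ∘L ContinuousLinearMap.inl ℝ _ _)).transpose *
        coordMatrix (T ∘L ContinuousLinearMap.inl ℝ _ _)).det *
      (coordMatrix A * (coordMatrix A).transpose).det ^ (-(1 / 2) : ℝ) := by
  have hsurj : Function.Surjective A := fun y => ⟨T (0, y), by
    simpa using congrArg (fun S => S (0, y)) hA⟩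
  have hpos := det_coordMatrix_mul_transpose_pos hsurj
  have hinj : Function.Injective (T ∘L ContinuousLinearMap.inl ℝ _ _) := by
    intro x y hxy
    simpa using congrArg Prod.fst (hT hxy)
  have hP := det_coordMatrix_transpose_mul_self_pos hinj
  have key := sq_det_fromCols_mul_det σ (coordMatrix (T ∘L ContinuousLinearMap.inl ℝ _ _))
    (coordMatrix (T ∘L ContinuousLinearMap.inr ℝ _ _)) (coordMatrix A)
    (by
      rw [← coordMatrix_comp, ← ContinuousLinearMap.comp_assoc, hA,
        ContinuousLinearMap.snd_comp_inl, coordMatrix_zero])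
    (by
      rw [← coordMatrix_comp, ← ContinuousLinearMap.comp_assoc, hA,
        ContinuousLinearMap.snd_comp_inr, coordMatrix_id]) hP.ne'
  rw [← det_splitCoords_comp] at key
  rw [← key, Real.sqrt_mul (sq_nonneg _), Real.sqrt_sq_eq_abs, Real.rpow_neg hpos.le,
    ← Real.sqrt_eq_rpow, mul_assoc, mul_inv_cancel₀ (Real.sqrt_pos.2 hpos).ne', mul_one]

/-! ### Averages over thin balls and tubes -/

/-- The Lebesgue volume of the ball of radius `ε` in `ℝⁿ`. -/
noncomputable def ballVolume (n : ℕ) (ε : ℝ) : ℝ :=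
  (volume : Measure (EuclideanSpace ℝ (Fin n))).real (Metric.closedBall 0 ε)

lemma ballVolume_pos (n : ℕ) {ε : ℝ} (hε : 0 < ε) : 0 < ballVolume n ε :=
  ENNReal.toReal_pos (Metric.measure_closedBall_pos _ _ hε).ne'
    (isCompact_closedBall _ _).measure_ne_top

/-- The averages of a continuous function on `ℝⁿ` over the balls about `0` tend to its value. -/
lemma tendsto_ball_average {n : ℕ} {f : EuclideanSpace ℝ (Fin n) → ℝ} (hf : Continuous f) :
    Tendsto (fun ε => (ballVolume n ε)⁻¹ * ∫ y in Metric.closedBall 0 ε, f y) (𝓝[>] 0)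
      (𝓝 (f 0)) := by
  have hs : Tendsto (fun ε : ℝ => Metric.closedBall (0 : EuclideanSpace ℝ (Fin n)) ε) (𝓝[>] 0)
      (𝓝 0).smallSets := by
    rw [tendsto_smallSets_iff]
    intro t ht
    obtain ⟨r, hr, hrt⟩ := Metric.nhds_basis_closedBall.mem_iff.1 ht
    filter_upwards [Ioo_mem_nhdsGT hr] with ε hε
    exact (Metric.closedBall_subset_closedBall hε.2.le).trans hrt
  have h1 := hf.continuousAt.integral_sub_linear_isLittleO_ae (μ := volume)
    (hf.stronglyMeasurable.stronglyMeasurableAtFilter) hs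
  have h2 := h1.tendsto_div_nhds_zero
  have h3 := h2.add_const (f 0)
  rw [zero_add] at h3
  refine h3.congr' ?_
  filter_upwards [self_mem_nhdsWithin] with ε hε
  have hv := (ballVolume_pos n hε).ne'
  change (_ - ballVolume n ε • f 0) / ballVolume n ε + f 0 = _
  rw [smul_eq_mul]
  field_simp
  ring

/-- The averages of a continuous compactly supported function on `ℝᵏ × ℝⁿ` over the tubes
`ℝᵏ × B_ε` tend to its integral over `ℝᵏ × {0}`. -/
lemma tendsto_tube_average {k n : ℕ} {F : EuclideanSpace ℝ (Fin k) × EuclideanSpace ℝ (Fin n) → ℝ}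
    (hF : Continuous F) (hF' : HasCompactSupport F) :
    Tendsto (fun ε => (ballVolume n ε)⁻¹ * ∫ p in {p | ‖p.2‖ ≤ ε}, F p) (𝓝[>] 0)
      (𝓝 (∫ u, F (u, 0))) := by
  -- For every `y` the inner integral runs over the same compact set `K`, hence is continuous in
  -- `y`. Fubini then reduces tubes to balls.
  set K := Prod.fst '' tsupport F with hK
  have hKc : IsCompact K := hF'.isCompact.image continuous_fst
  have hz : ∀ u ∉ K, ∀ y, F (u, y) = 0 := fun u hu y => by
    by_contra h0
    exact hu ⟨(u, y), subset_tsupport F h0, rfl⟩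
  have hint : ∀ y, ∫ u, F (u, y) = ∫ u in K, F (u, y) := fun y =>
    (setIntegral_eq_integral_of_forall_compl_eq_zero fun u hu => hz u hu y).symm
  have hcont : Continuous fun y => ∫ u, F (u, y) := by
    simp_rw [hint]
    exact continuous_parametric_integral_of_continuous (f := fun y u => F (u, y))
      (by fun_prop) hKc
  refine (tendsto_ball_average hcont).congr' ?_
  filter_upwards with ε
  congr 1
  have hset : {p : EuclideanSpace ℝ (Fin k) × EuclideanSpace ℝ (Fin n) | ‖p.2‖ ≤ ε} =
      Set.univ ×ˢ Metric.closedBall 0 ε := by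
    ext p; simp
  rw [hset, Measure.volume_eq_prod, ← setIntegral_prod_swap, setIntegral_prod]
  · simp
  · exact ((hF.integrable_of_hasCompactSupport hF').swap).integrableOn

/-! ### Straightening the submersion -/

/-- A diffeomorphism `G` from an open subset of `ℝᵏ × ℝⁿ` to an open subset of `X`, in whose
coordinates `h` is the projection to `ℝⁿ`. -/
structure IsStraightening {d k n : ℕ} (X : Set (EuclideanSpace ℝ (Fin d)))
    (h : EuclideanSpace ℝ (Fin d) → EuclideanSpace ℝ (Fin n))
    (G : OpenPartialHomeomorph (EuclideanSpace ℝ (Fin k) × EuclideanSpace ℝ (Fin n))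
      (EuclideanSpace ℝ (Fin d))) : Prop where
  target_subset : G.target ⊆ X
  contDiffAt : ∀ p ∈ G.source, ContDiffAt ℝ 2 G p
  contDiffAt_symm : ∀ p ∈ G.source, ContDiffAt ℝ 2 G.symm (G p)
  apply_eq_snd : ∀ p ∈ G.source, h (G p) = p.2

/-- A local immersion whose differential maps into the kernel of the differential of the
submersion `h` extends to a straightening of `h`, as long as it maps into the zero set of `h`. -/
lemma exists_isStraightening {d k n : ℕ} (σ : Fin d ≃ Fin k ⊕ Fin n)
    {X : Set (EuclideanSpace ℝ (Fin d))} (hX : IsOpen X)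
    {h : EuclideanSpace ℝ (Fin d) → EuclideanSpace ℝ (Fin n)} (h_smooth : ContDiffOn ℝ 2 h X)
    {φ : EuclideanSpace ℝ (Fin k) → EuclideanSpace ℝ (Fin d)} {u₀ : EuclideanSpace ℝ (Fin k)}
    (hφ : ContDiffAt ℝ 2 φ u₀) (hmem : φ u₀ ∈ X) (hzero : h (φ u₀) = 0)
    (hsurj : Function.Surjective (fderiv ℝ h (φ u₀)))
    (hinj : Function.Injective (fderiv ℝ φ u₀))
    (hcomp : fderiv ℝ h (φ u₀) ∘L fderiv ℝ φ u₀ = 0)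
    {N : Set (EuclideanSpace ℝ (Fin k))} (hN : N ∈ 𝓝 u₀) :
    ∃ G : OpenPartialHomeomorph (EuclideanSpace ℝ (Fin k) × EuclideanSpace ℝ (Fin n))
        (EuclideanSpace ℝ (Fin d)),
      IsStraightening X h G ∧ (u₀, 0) ∈ G.source ∧ (∀ p ∈ G.source, p.1 ∈ N) ∧
      ∀ u, (u, 0) ∈ G.source → h (φ u) = 0 → G (u, 0) = φ u := by
  set A := fderiv ℝ h (φ u₀) with hA
  obtain ⟨L₀, hL₀⟩ := A.toLinearMap.exists_rightInverse_of_surjective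
    (LinearMap.range_eq_top.2 hsurj)
  set L : EuclideanSpace ℝ (Fin n) →L[ℝ] EuclideanSpace ℝ (Fin d) := L₀.toContinuousLinearMap
  have hL : ∀ t, A (L t) = t := fun t => congrArg (fun S => S t) hL₀
  have hA' : ∀ u, A (fderiv ℝ φ u₀ u) = 0 := fun u => congrArg (fun S => S u) hcomp
  have hh : ContDiffAt ℝ 2 h (φ u₀) := h_smooth.contDiffAt (hX.mem_nhds hmem)
  -- `Θ` thickens `φ` in the directions of a right inverse `L` of `A`. Since `A` kills the image of
  -- `Dφ`, the differential of `h ∘ Θ` at the base point is the projection `snd`.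
  set Θ : EuclideanSpace ℝ (Fin k) × EuclideanSpace ℝ (Fin n) → EuclideanSpace ℝ (Fin d) :=
    fun p => φ p.1 + L p.2 with hΘ
  have hΘ0 : Θ (u₀, 0) = φ u₀ := by simp [hΘ]
  have hΘc : ContDiffAt ℝ 2 Θ (u₀, 0) :=
    (ContDiffAt.comp (u₀, (0 : EuclideanSpace ℝ (Fin n))) hφ contDiffAt_fst).add
      (L.contDiff.contDiffAt.comp _ contDiffAt_snd)
  set T : EuclideanSpace ℝ (Fin k) × EuclideanSpace ℝ (Fin n) →L[ℝ] EuclideanSpace ℝ (Fin d) :=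
    fderiv ℝ φ u₀ ∘L ContinuousLinearMap.fst ℝ _ _ + L ∘L ContinuousLinearMap.snd ℝ _ _ with hT
  have hΘd : HasFDerivAt Θ T (u₀, 0) := by
    have h1 : HasFDerivAt φ (fderiv ℝ φ u₀) (u₀, (0 : EuclideanSpace ℝ (Fin n))).1 :=
      (hφ.differentiableAt (by norm_num)).hasFDerivAt
    exact (h1.comp _ hasFDerivAt_fst).add (L.hasFDerivAt.comp _ hasFDerivAt_snd)
  have hAT : A ∘L T = ContinuousLinearMap.snd ℝ _ _ := by
    ext1
    · ext1 u; simp [hT, hA']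
    · ext1 t; simp [hT, hL]
  have hTinj : Function.Injective T := by
    refine (injective_iff_map_eq_zero T).2 fun p hp => ?_
    have h1 : p.2 = 0 := by
      have := congrArg (fun S => S p) hAT
      simpa [hp] using this.symm
    have h2 : fderiv ℝ φ u₀ p.1 = 0 := by simpa [hT, h1] using hp
    exact Prod.ext ((injective_iff_map_eq_zero _).1 hinj _ h2) h1
  have hfin : Module.finrank ℝ (EuclideanSpace ℝ (Fin k) × EuclideanSpace ℝ (Fin n)) =
      Module.finrank ℝ (EuclideanSpace ℝ (Fin d)) := (splitCoords σ).toLinearEquiv.finrank_eq.symm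
  let Te : (EuclideanSpace ℝ (Fin k) × EuclideanSpace ℝ (Fin n)) ≃L[ℝ] EuclideanSpace ℝ (Fin d) :=
    (LinearEquiv.ofInjectiveOfFinrankEq T.toLinearMap hTinj hfin).toContinuousLinearEquiv
  have hTe : (Te : _ →L[ℝ] _) = T := by ext1 <;> rfl
  -- `Ξ` makes the value of `h` the second coordinate, and its differential at the base point is the
  -- identity. Hence `Θ ∘ Ξ⁻¹` is the wanted straightening.
  set Ξ : EuclideanSpace ℝ (Fin k) × EuclideanSpace ℝ (Fin n) →
      EuclideanSpace ℝ (Fin k) × EuclideanSpace ℝ (Fin n) := fun p => (p.1, h (Θ p)) with hΞ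
  have hΞ0 : Ξ (u₀, 0) = (u₀, 0) := by simp [hΞ, hΘ0, hzero]
  have hΞc : ContDiffAt ℝ 2 Ξ (u₀, 0) :=
    contDiffAt_fst.prodMk (ContDiffAt.comp _ (by rw [hΘ0]; exact hh) hΘc)
  have hΞd : HasFDerivAt Ξ
      ((ContinuousLinearEquiv.refl ℝ (EuclideanSpace ℝ (Fin k) × EuclideanSpace ℝ (Fin n)) :
        _ →L[ℝ] _)) (u₀, 0) := by
    have h1 : HasFDerivAt h A (Θ (u₀, 0)) := by
      rw [hΘ0]; exact (hh.differentiableAt (by norm_num)).hasFDerivAt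
    have h2 := (hasFDerivAt_fst (𝕜 := ℝ) (p := (u₀, (0 : EuclideanSpace ℝ (Fin n))))).prodMk
      (h1.comp _ hΘd)
    rw [hAT] at h2
    exact h2
  have hΘd' : HasFDerivAt Θ (Te : _ →L[ℝ] _) (u₀, 0) := by rw [hTe]; exact hΘd
  set ΘP := hΘc.toOpenPartialHomeomorph Θ hΘd' (by norm_num)
  set ΞP := hΞc.toOpenPartialHomeomorph Ξ hΞd (by norm_num)
  have cΘ : ∀ p, ΘP p = Θ p := fun _ => rfl
  have cΞ : ∀ p, ΞP p = Ξ p := fun _ => rfl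
  have mΘ : (u₀, 0) ∈ ΘP.source := hΘc.mem_toOpenPartialHomeomorph_source hΘd' (by norm_num)
  have mΞ : (u₀, 0) ∈ ΞP.source := hΞc.mem_toOpenPartialHomeomorph_source hΞd (by norm_num)
  have mΞ' : (u₀, 0) ∈ ΞP.target := by
    have := ΞP.map_source mΞ
    rwa [cΞ, hΞ0] at this
  have sΞ : ΞP.symm (u₀, 0) = (u₀, 0) := by
    have := ΞP.left_inv mΞ
    rwa [cΞ, hΞ0] at this
  have mΘ' : φ u₀ ∈ ΘP.target := by
    have := ΘP.map_source mΘ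
    rwa [cΘ, hΘ0] at this
  have sΘ : ΘP.symm (φ u₀) = (u₀, 0) := by
    have := ΘP.left_inv mΘ
    rwa [cΘ, hΘ0] at this
  have cΞs : ContDiffAt ℝ 2 ΞP.symm (u₀, 0) :=
    ΞP.contDiffAt_symm mΞ' (by rw [sΞ]; exact hΞd) (by rw [sΞ]; exact hΞc)
  have cΘs : ContDiffAt ℝ 2 ΘP.symm (φ u₀) :=
    ΘP.contDiffAt_symm mΘ' (by rw [sΘ]; exact hΘd') (by rw [sΘ]; exact hΘc)
  set G₀ := ΞP.symm.trans ΘP with hG₀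
  have cG : ∀ p, G₀ p = Θ (ΞP.symm p) := fun _ => rfl
  have mG : (u₀, 0) ∈ G₀.source := by
    rw [hG₀, OpenPartialHomeomorph.trans_source]
    exact ⟨mΞ', by rw [Set.mem_preimage, sΞ]; exact mΘ⟩
  have G0 : G₀ (u₀, 0) = φ u₀ := by rw [cG, sΞ, hΘ0]
  have dG : ContDiffAt ℝ 2 G₀ (u₀, 0) :=
    ContDiffAt.comp (g := Θ) (f := ΞP.symm) _ (by rw [sΞ]; exact hΘc) cΞs
  have dGs : ContDiffAt ℝ 2 G₀.symm (G₀ (u₀, 0)) := by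
    rw [G0]
    exact ContDiffAt.comp (g := Ξ) (f := ΘP.symm) _ (by rw [sΘ]; exact hΞc) cΘs
  have hcontG := G₀.continuousAt mG
  -- The domain is shrunk so that regularity holds at all its points. Requiring `(p.1, 0) ∈
  -- ΞP.source` allows `Ξ (u, 0) = (u, 0)` to be inverted when `h (φ u) = 0`, which yields `G (u, 0)
  -- = φ u`.
  set S : Set (EuclideanSpace ℝ (Fin k) × EuclideanSpace ℝ (Fin n)) :=
    {p | ContDiffAt ℝ 2 G₀ p ∧ ContDiffAt ℝ 2 G₀.symm (G₀ p) ∧ G₀ p ∈ X ∧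
      (p.1, (0 : EuclideanSpace ℝ (Fin n))) ∈ ΞP.source ∧ p.1 ∈ N}
  have hS : S ∈ 𝓝 (u₀, (0 : EuclideanSpace ℝ (Fin n))) := by
    have hc : ContinuousAt
        (fun p : EuclideanSpace ℝ (Fin k) × EuclideanSpace ℝ (Fin n) =>
          (p.1, (0 : EuclideanSpace ℝ (Fin n)))) (u₀, 0) := by fun_prop
    filter_upwards [dG.eventually (by norm_num), hcontG.eventually (dGs.eventually (by norm_num)),
      hcontG.preimage_mem_nhds (hX.mem_nhds (by rw [G0]; exact hmem)),
      hc.preimage_mem_nhds (ΞP.open_source.mem_nhds mΞ),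
      continuousAt_fst.preimage_mem_nhds (x := (u₀, (0 : EuclideanSpace ℝ (Fin n)))) hN]
      with p h1 h2 h3 h4 h5
    exact ⟨h1, h2, h3, h4, h5⟩
  have hsrc : ∀ p ∈ (G₀.restr S).source, p ∈ G₀.source ∧ p ∈ S := fun p hp => by
    rw [OpenPartialHomeomorph.restr_source] at hp
    exact ⟨hp.1, interior_subset hp.2⟩
  refine ⟨G₀.restr S, ⟨?_, ?_, ?_, ?_⟩, ?_, ?_, ?_⟩
  · intro x hx
    have h1 := (G₀.restr S).map_target hx
    have h2 := (hsrc _ h1).2.2.2.1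
    have h3 := (G₀.restr S).right_inv hx
    rw [← h3]; exact h2
  · exact fun p hp => (hsrc p hp).2.1
  · exact fun p hp => (hsrc p hp).2.2.1
  · intro p hp
    have h1 := (hsrc p hp).1
    rw [hG₀, OpenPartialHomeomorph.trans_source] at h1
    have h2 := ΞP.right_inv h1.1
    rw [cΞ] at h2
    exact congrArg Prod.snd h2
  · rw [OpenPartialHomeomorph.restr_source]
    exact ⟨mG, mem_interior_iff_mem_nhds.2 hS⟩
  · exact fun p hp => (hsrc p hp).2.2.2.2.2
  · intro u hu hu0
    have h1 : (u, (0 : EuclideanSpace ℝ (Fin n))) ∈ ΞP.source := (hsrc _ hu).2.2.2.2.1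
    have h2 : Θ (u, 0) = φ u := by simp [hΘ]
    have h3 : Ξ (u, 0) = (u, 0) := by simp only [hΞ, h2, hu0]
    have h4 := ΞP.left_inv h1
    rw [cΞ, h3] at h4
    change Θ (ΞP.symm (u, 0)) = φ u
    rw [h4, h2]

/-! ### The coarea weight and integrals against chart measures -/

/-- The weight `det (∇h ∇hᵀ)^{-1/2}`. -/
noncomputable def coareaWeight {d n : ℕ}
    (h : EuclideanSpace ℝ (Fin d) → EuclideanSpace ℝ (Fin n)) (x : EuclideanSpace ℝ (Fin d)) : ℝ :=
  (jacobian h x * (jacobian h x).transpose).det ^ (-(1 / 2) : ℝ)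

lemma ContDiffOn.continuousOn_jacobian {p q : ℕ}
    {f : EuclideanSpace ℝ (Fin p) → EuclideanSpace ℝ (Fin q)} {U : Set (EuclideanSpace ℝ (Fin p))}
    (hf : ContDiffOn ℝ 2 f U) (hU : IsOpen U) : ContinuousOn (jacobian f) U := by
  have h1 : ContinuousOn (fderiv ℝ f) U := hf.continuousOn_fderiv_of_isOpen hU (by norm_num)
  refine continuousOn_pi.2 fun i => continuousOn_pi.2 fun j => ?_
  have h2 : ContinuousOn (fun x => fderiv ℝ f x (EuclideanSpace.single j 1)) U :=
    h1.clm_apply continuousOn_const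
  exact (EuclideanSpace.proj (𝕜 := ℝ) i).continuous.comp_continuousOn h2

lemma coareaWeight_pos {d n : ℕ} {h : EuclideanSpace ℝ (Fin d) → EuclideanSpace ℝ (Fin n)}
    {x : EuclideanSpace ℝ (Fin d)} (hx : Function.Surjective (fderiv ℝ h x)) :
    0 < coareaWeight h x :=
  Real.rpow_pos_of_pos (det_coordMatrix_mul_transpose_pos hx) _

lemma continuousOn_coareaWeight {d n : ℕ} {X : Set (EuclideanSpace ℝ (Fin d))} (hX : IsOpen X)
    {h : EuclideanSpace ℝ (Fin d) → EuclideanSpace ℝ (Fin n)} (h_smooth : ContDiffOn ℝ 2 h X)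
    (h_submersion : ∀ x ∈ X, Function.Surjective (fderiv ℝ h x)) :
    ContinuousOn (coareaWeight h) X := by
  have h1 := h_smooth.continuousOn_jacobian hX
  have h2 : Continuous fun A : Matrix (Fin n) (Fin d) ℝ => (A * A.transpose).det := by fun_prop
  exact (h2.comp_continuousOn h1).rpow_const fun x hx =>
    Or.inl (det_coordMatrix_mul_transpose_pos (h_submersion x hx)).ne'

lemma continuousOn_sqrt_det_jacobian {d k : ℕ} {U : Set (EuclideanSpace ℝ (Fin k))} (hU : IsOpen U)
    {φ : EuclideanSpace ℝ (Fin k) → EuclideanSpace ℝ (Fin d)} (hφ : ContDiffOn ℝ 2 φ U) :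
    ContinuousOn (fun u => Real.sqrt ((jacobian φ u).transpose * jacobian φ u).det) U := by
  have h2 : Continuous fun A : Matrix (Fin d) (Fin k) ℝ => Real.sqrt (A.transpose * A).det := by
    fun_prop
  exact h2.comp_continuousOn (hφ.continuousOn_jacobian hU)

lemma aemeasurable_chart {d k : ℕ} {U : Set (EuclideanSpace ℝ (Fin k))}
    (hU : IsOpen U) {φ : EuclideanSpace ℝ (Fin k) → EuclideanSpace ℝ (Fin d)}
    (hφ : ContDiffOn ℝ 2 φ U) :
    AEMeasurable φ ((volume.restrict U).withDensity fun u =>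
      ENNReal.ofReal (Real.sqrt ((jacobian φ u).transpose * jacobian φ u).det)) :=
  (hφ.continuousOn.aemeasurable hU.measurableSet).mono_ac (withDensity_absolutelyContinuous _ _)

lemma integral_chartMeasure {d k : ℕ} {U : Set (EuclideanSpace ℝ (Fin k))} (hU : IsOpen U)
    {φ : EuclideanSpace ℝ (Fin k) → EuclideanSpace ℝ (Fin d)} (hφ : ContDiffOn ℝ 2 φ U)
    {f : EuclideanSpace ℝ (Fin d) → ℝ} (hf : Continuous f) :
    ∫ x, f x ∂(chartMeasure U φ) =
      ∫ u in U, Real.sqrt ((jacobian φ u).transpose * jacobian φ u).det * f (φ u) := by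
  rw [chartMeasure, integral_map (aemeasurable_chart hU hφ)
    hf.aestronglyMeasurable, integral_withDensity_eq_integral_toReal_smul₀]
  · simp only [ENNReal.toReal_ofReal (Real.sqrt_nonneg _), smul_eq_mul]
  · exact ((continuousOn_sqrt_det_jacobian hU hφ).aemeasurable hU.measurableSet).ennreal_ofReal
  · simp

lemma integrable_chartMeasure_iff {d k : ℕ} {U : Set (EuclideanSpace ℝ (Fin k))} (hU : IsOpen U)
    {φ : EuclideanSpace ℝ (Fin k) → EuclideanSpace ℝ (Fin d)} (hφ : ContDiffOn ℝ 2 φ U)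
    {f : EuclideanSpace ℝ (Fin d) → ℝ} (hf : Continuous f) :
    Integrable f (chartMeasure U φ) ↔
      IntegrableOn (fun u => Real.sqrt ((jacobian φ u).transpose * jacobian φ u).det * f (φ u))
        U := by
  rw [chartMeasure, integrable_map_measure hf.aestronglyMeasurable
    (aemeasurable_chart hU hφ), integrable_withDensity_iff_integrable_smul₀']
  · simp only [ENNReal.toReal_ofReal (Real.sqrt_nonneg _), smul_eq_mul, Function.comp_apply]
    rfl
  · exact ((continuousOn_sqrt_det_jacobian hU hφ).aemeasurable hU.measurableSet).ennreal_ofReal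
  · simp

/-! ### Change of variables in a straightening -/

/-- The slice of the source of a straightening over `y = 0`. -/
def zeroSlice {d k n : ℕ}
    (G : OpenPartialHomeomorph (EuclideanSpace ℝ (Fin k) × EuclideanSpace ℝ (Fin n))
      (EuclideanSpace ℝ (Fin d))) : Set (EuclideanSpace ℝ (Fin k)) :=
  {u | (u, (0 : EuclideanSpace ℝ (Fin n))) ∈ G.source}

namespace IsStraightening

variable {d k n : ℕ} {X : Set (EuclideanSpace ℝ (Fin d))}
  {h : EuclideanSpace ℝ (Fin d) → EuclideanSpace ℝ (Fin n)}
  {G : OpenPartialHomeomorph (EuclideanSpace ℝ (Fin k) × EuclideanSpace ℝ (Fin n))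
      (EuclideanSpace ℝ (Fin d))}

lemma mem_of_mem_source (hG : IsStraightening X h G) {p} (hp : p ∈ G.source) : G p ∈ X :=
  hG.target_subset (G.map_source hp)

lemma injective_fderiv (hG : IsStraightening X h G) {p} (hp : p ∈ G.source) :
    Function.Injective (fderiv ℝ G p) := by
  have h1 : HasFDerivAt G (fderiv ℝ G p) p :=
    ((hG.contDiffAt p hp).differentiableAt (by norm_num)).hasFDerivAt
  have h2 : HasFDerivAt G.symm (fderiv ℝ G.symm (G p)) (G p) :=
    ((hG.contDiffAt_symm p hp).differentiableAt (by norm_num)).hasFDerivAt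
  have h3 := (h2.comp p h1).congr_of_eventuallyEq (f₁ := id) (by
    filter_upwards [G.open_source.mem_nhds hp] with q hq
    exact (G.left_inv hq).symm)
  have h4 := h3.unique (hasFDerivAt_id p)
  exact Function.LeftInverse.injective (g := fderiv ℝ G.symm (G p))
    fun v => congrArg (fun S => S v) h4

lemma fderiv_comp_fderiv (hG : IsStraightening X h G) (hX : IsOpen X) (h_smooth : ContDiffOn ℝ 2 h X)
    {p} (hp : p ∈ G.source) :
    fderiv ℝ h (G p) ∘L fderiv ℝ G p = ContinuousLinearMap.snd ℝ _ _ := by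
  have h1 : HasFDerivAt G (fderiv ℝ G p) p :=
    ((hG.contDiffAt p hp).differentiableAt (by norm_num)).hasFDerivAt
  have h2 : HasFDerivAt h (fderiv ℝ h (G p)) (G p) :=
    ((h_smooth.contDiffAt (hX.mem_nhds (hG.mem_of_mem_source hp))).differentiableAt
      (by norm_num)).hasFDerivAt
  have h3 := (h2.comp p h1).congr_of_eventuallyEq (f₁ := Prod.snd) (by
    filter_upwards [G.open_source.mem_nhds hp] with q hq
    exact (hG.apply_eq_snd q hq).symm)
  exact h3.unique hasFDerivAt_snd

lemma isOpen_zeroSlice : IsOpen (zeroSlice G) :=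
  G.open_source.preimage (by fun_prop)

lemma fderiv_slice (hG : IsStraightening X h G) {u} (hu : u ∈ zeroSlice G) :
    fderiv ℝ (fun u => G (u, 0)) u = fderiv ℝ G (u, 0) ∘L ContinuousLinearMap.inl ℝ _ _ := by
  have h1 : HasFDerivAt G (fderiv ℝ G (u, 0)) (u, 0) :=
    ((hG.contDiffAt _ hu).differentiableAt (by norm_num)).hasFDerivAt
  exact (h1.comp u (hasFDerivAt_prodMk_left u 0)).fderiv

lemma contDiffOn_slice (hG : IsStraightening X h G) :
    ContDiffOn ℝ 2 (fun u => G (u, 0)) (zeroSlice G) := fun u hu =>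
  (ContDiffAt.comp u (hG.contDiffAt _ hu) (by fun_prop)).contDiffWithinAt

/-- This makes the zero slice one of the charts in the supremum defining `riemannianMeasure`. Its
images are relatively open because a point `G (u, y)` lies in `M` only if `y = 0`: the image of `V`
is the trace on `M` of `G` applied to the part of its source over `V`. -/
lemma isLocalParam (hG : IsStraightening X h G) :
    IsLocalParam (levelSet X h) (zeroSlice G) (fun u => G (u, 0)) where
  isOpen := isOpen_zeroSlice
  contDiffOn := hG.contDiffOn_slice
  injOn := fun u hu v hv huv => congrArg Prod.fst (G.injOn hu hv huv)
  immersion := fun u hu => by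
    rw [hG.fderiv_slice hu]
    intro v w hvw
    exact congrArg Prod.fst (hG.injective_fderiv hu hvw)
  image_open := fun V hV hVo => by
    refine ⟨G '' (G.source ∩ Prod.fst ⁻¹' V), G.isOpen_image_of_subset_source
      (G.open_source.inter (hVo.preimage continuous_fst)) Set.inter_subset_left, ?_⟩
    ext x
    constructor
    · rintro ⟨u, hu, rfl⟩
      have hu' : (u, 0) ∈ G.source := hV hu
      exact ⟨⟨_, ⟨hu', hu⟩, rfl⟩, hG.mem_of_mem_source hu', hG.apply_eq_snd _ hu'⟩
    · rintro ⟨⟨⟨u, y⟩, ⟨hp, hu⟩, rfl⟩, -, hx⟩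
      obtain rfl : y = 0 := by rw [← hx, hG.apply_eq_snd _ hp]
      exact ⟨u, hu, rfl⟩

lemma abs_det_eq (hG : IsStraightening X h G) (hX : IsOpen X) (h_smooth : ContDiffOn ℝ 2 h X)
    (σ : Fin d ≃ Fin k ⊕ Fin n) {u} (hu : u ∈ zeroSlice G) :
    |((splitCoords σ).toContinuousLinearMap ∘L fderiv ℝ G (u, 0)).det| =
      Real.sqrt ((jacobian (fun u => G (u, 0)) u).transpose * jacobian (fun u => G (u, 0)) u).det *
        coareaWeight h (G (u, 0)) := by
  rw [abs_det_splitCoords_comp σ (hG.injective_fderiv hu) (hG.fderiv_comp_fderiv hX h_smooth hu),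
    ← hG.fderiv_slice hu]
  rfl

lemma setIntegral_image (hG : IsStraightening X h G) (σ : Fin d ≃ Fin k ⊕ Fin n)
    {S : Set (EuclideanSpace ℝ (Fin k) × EuclideanSpace ℝ (Fin n))} (hS : MeasurableSet S)
    (hSG : S ⊆ G.source) (g : EuclideanSpace ℝ (Fin d) → ℝ) :
    ∫ x in G '' S, g x =
      ∫ p in S, |((splitCoords σ).toContinuousLinearMap ∘L fderiv ℝ G p).det| * g (G p) := by
  have : (volume : Measure
      (EuclideanSpace ℝ (Fin k) × EuclideanSpace ℝ (Fin n))).IsAddHaarMeasure := by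
    rw [Measure.volume_eq_prod]; infer_instance
  have h1 := integral_image_eq_integral_abs_det_fderiv_smul volume (f := splitCoords σ ∘ G)
    (f' := fun p => (splitCoords σ).toContinuousLinearMap ∘L fderiv ℝ G p) hS
    (fun p hp => ((splitCoords σ).toContinuousLinearMap.hasFDerivAt.comp p
      ((hG.contDiffAt p (hSG hp)).differentiableAt (by norm_num)).hasFDerivAt).hasFDerivWithinAt)
    ((splitCoords σ).injective.comp_injOn (G.injOn.mono hSG)) (g ∘ (splitCoords σ).symm)
  simp only [smul_eq_mul, Function.comp_apply, ContinuousLinearEquiv.symm_apply_apply] at h1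
  rw [← h1, show (fun p => splitCoords σ (G p)) '' S = splitCoords σ '' (G '' S) from
    Set.image_comp _ _ _, (splitCoords_measurePreserving σ).setIntegral_image_emb
    (splitCoords σ).toHomeomorph.measurableEmbedding]
  simp

/-- The limit formula for the normalized integrals over the fattenings of the zero set, for
functions supported in the domain of a straightening. -/
lemma tendsto_fattening_integral (hG : IsStraightening X h G) (hX : IsOpen X)
    (h_smooth : ContDiffOn ℝ 2 h X)
    (h_submersion : ∀ x ∈ X, Function.Surjective (fderiv ℝ h x))
    (σ : Fin d ≃ Fin k ⊕ Fin n) {g : EuclideanSpace ℝ (Fin d) → ℝ} (hg : Continuous g)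
    (hgc : HasCompactSupport g) (hgG : tsupport g ⊆ G.target) :
    Integrable (fun x => g x * coareaWeight h x)
      (chartMeasure (zeroSlice G) fun u => G (u, 0)) ∧
    Tendsto (fun ε => (ballVolume n ε)⁻¹ * ∫ x in fattening X h ε, g x) (𝓝[>] 0)
      (𝓝 (∫ x, g x * coareaWeight h x ∂(chartMeasure (zeroSlice G) fun u => G (u, 0)))) := by
  set D := fun p => |((splitCoords σ).toContinuousLinearMap ∘L fderiv ℝ G p).det| with hD
  -- The integrand in straightened coordinates, extended by zero. It is continuous on the whole
  -- space because its support lies in the compact set `G.symm '' tsupport g` inside the source.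
  set F := G.source.indicator fun p => D p * g (G p) with hF
  have hDc : ContinuousOn D G.source := by
    have h1 : ContinuousOn (fderiv ℝ G) G.source :=
      ContDiffOn.continuousOn_fderiv_of_isOpen
        (fun p hp => (hG.contDiffAt p hp).contDiffWithinAt) G.open_source (n := 2) (by norm_num)
    have h2 : Continuous fun T : EuclideanSpace ℝ (Fin k) × EuclideanSpace ℝ (Fin n) →L[ℝ]
        EuclideanSpace ℝ (Fin d) => |((splitCoords σ).toContinuousLinearMap ∘L T).det| := by
      refine (ContinuousLinearMap.continuous_det.comp ?_).abs
      fun_prop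
    exact h2.comp_continuousOn h1
  have hK : IsCompact (G.symm '' tsupport g) :=
    hgc.isCompact.image_of_continuousOn (G.continuousOn_symm.mono hgG)
  have hFsupp : Function.support F ⊆ G.symm '' tsupport g := by
    intro p hp
    have hps : p ∈ G.source := Set.mem_of_indicator_ne_zero hp
    refine ⟨G p, subset_tsupport g ?_, G.left_inv hps⟩
    intro h0
    apply hp
    simp [hF, hps, h0]
  have hFt : tsupport F ⊆ G.symm '' tsupport g := closure_minimal hFsupp hK.isClosed
  have hKs : G.symm '' tsupport g ⊆ G.source := by
    rintro _ ⟨x, hx, rfl⟩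
    exact G.map_target (hgG hx)
  have hFcomp : HasCompactSupport F := hK.of_isClosed_subset (isClosed_tsupport F) hFt
  have hFc : Continuous F := by
    refine ContinuousOn.continuous_of_tsupport_subset (s := G.source) ?_ G.open_source
      (hFt.trans hKs)
    refine ContinuousOn.congr (f := fun p => D p * g (G p)) ?_ fun p hp => by
      simp [hF, hp]
    exact hDc.mul (hg.comp_continuousOn G.continuousOn)
  have hgw : Continuous fun x => g x * coareaWeight h x := by
    refine ContinuousOn.continuous_of_tsupport_subset (s := X)
      (hg.continuousOn.mul (continuousOn_coareaWeight hX h_smooth h_submersion)) hX ?_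
    exact (tsupport_mul_subset_left).trans (hgG.trans hG.target_subset)
  have hF0 : (fun u => F (u, 0)) = (zeroSlice G).indicator fun u =>
      Real.sqrt ((jacobian (fun u => G (u, 0)) u).transpose * jacobian (fun u => G (u, 0)) u).det *
        (g (G (u, 0)) * coareaWeight h (G (u, 0))) := by
    ext u
    by_cases hu : u ∈ zeroSlice G
    · have hu' : (u, 0) ∈ G.source := hu
      rw [hF, Set.indicator_of_mem hu, Set.indicator_of_mem hu', hD]
      simp only
      rw [hG.abs_det_eq hX h_smooth σ hu]
      ring
    · have hu' : (u, 0) ∉ G.source := hu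
      rw [hF, Set.indicator_of_notMem hu, Set.indicator_of_notMem hu']
  have hF0c : Continuous fun u => F (u, 0) := by fun_prop
  have hF0s : HasCompactSupport fun u => F (u, 0) := by
    refine HasCompactSupport.intro (hK.image continuous_fst) fun u hu => ?_
    by_contra h0
    exact hu ⟨(u, 0), hFsupp h0, rfl⟩
  constructor
  · rw [integrable_chartMeasure_iff isOpen_zeroSlice hG.contDiffOn_slice hgw,
      ← integrable_indicator_iff isOpen_zeroSlice.measurableSet, ← hF0]
    exact hF0c.integrable_of_hasCompactSupport hF0s
  · rw [integral_chartMeasure isOpen_zeroSlice hG.contDiffOn_slice hgw,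
      ← integral_indicator isOpen_zeroSlice.measurableSet, ← hF0]
    refine (tendsto_tube_average hFc hFcomp).congr fun ε => ?_
    congr 1
    have hT : MeasurableSet {p : EuclideanSpace ℝ (Fin k) × EuclideanSpace ℝ (Fin n) | ‖p.2‖ ≤ ε} :=
      (isClosed_le (by fun_prop) continuous_const).measurableSet
    have hs : G '' ({p | ‖p.2‖ ≤ ε} ∩ G.source) = fattening X h ε ∩ G.target := by
      ext x
      constructor
      · rintro ⟨p, ⟨hp, hps⟩, rfl⟩
        refine ⟨⟨hG.mem_of_mem_source hps, ?_⟩, G.map_source hps⟩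
        rw [hG.apply_eq_snd p hps]; exact hp
      · rintro ⟨⟨hx, hxε⟩, hxt⟩
        refine ⟨G.symm x, ⟨?_, G.map_target hxt⟩, G.right_inv hxt⟩
        have := hG.apply_eq_snd _ (G.map_target hxt)
        rw [G.right_inv hxt] at this
        change ‖(G.symm x).2‖ ≤ ε
        rw [← this]; exact hxε
    rw [hF, setIntegral_indicator G.open_source.measurableSet,
      ← hG.setIntegral_image σ (hT.inter G.open_source.measurableSet) Set.inter_subset_right, hs,
      ← setIntegral_indicator G.open_target.measurableSet]
    congr 1
    rw [Set.indicator_eq_self]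
    exact (subset_tsupport g).trans hgG

end IsStraightening

/-! ### Chart measures agree and glue to the Riemannian measure -/

/-- By second countability, countably many of the neighbourhoods cover `S`. -/
lemma restrict_eq_of_forall_nhds {α : Type*} [TopologicalSpace α] [SecondCountableTopology α]
    [MeasurableSpace α] {μ ν : Measure α} {S : Set α}
    (H : ∀ x ∈ S, ∃ O ∈ 𝓝 x, μ.restrict O = ν.restrict O) : μ.restrict S = ν.restrict S := by
  choose! O hO hμν using H
  obtain ⟨t, htS, htc, hcov⟩ := TopologicalSpace.countable_cover_nhdsWithin
    (f := O) (s := S) fun x hx => mem_nhdsWithin_of_mem_nhds (hO x hx)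
  exact Measure.restrict_congr_mono hcov
    ((Measure.restrict_biUnion_congr htc).2 fun x hx => hμν x (htS hx))

/-- Where the density is nonzero it can be divided out again. -/
lemma restrict_eq_of_withDensity_eq {α : Type*} [MeasurableSpace α] {μ ν : Measure α}
    {ρ : α → ℝ≥0∞} (hρ : Measurable ρ) (hρ' : ∀ x, ρ x ≠ ∞)
    (H : μ.withDensity ρ = ν.withDensity ρ) :
    μ.restrict {x | ρ x ≠ 0} = ν.restrict {x | ρ x ≠ 0} := by
  have hs : MeasurableSet {x | ρ x ≠ 0} := (hρ (measurableSet_singleton 0)).compl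
  have key : ∀ κ : Measure α, ((κ.withDensity ρ).restrict {x | ρ x ≠ 0}).withDensity
      (fun x => (ρ x)⁻¹) = κ.restrict {x | ρ x ≠ 0} := fun κ => by
    rw [restrict_withDensity hs]
    exact withDensity_inv_same hρ (ae_restrict_mem hs) (ae_of_all _ hρ')
  rw [← key μ, ← key ν, H]

lemma exists_cutoff {α : Type*} [TopologicalSpace α] [T2Space α] [LocallyCompactSpace α]
    {K O : Set α} (hK : IsCompact K) (hO : IsOpen O) (hKO : K ⊆ O) :
    ∃ χ : α → ℝ, Continuous χ ∧ HasCompactSupport χ ∧ tsupport χ ⊆ O ∧ (∀ x ∈ K, χ x = 1) ∧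
      ∀ x, χ x ∈ Set.Icc (0 : ℝ) 1 := by
  obtain ⟨f, h1, h2, h3, h4⟩ := exists_continuous_sum_one_of_isOpen_isCompact (n := 1)
    (s := fun _ => O) (fun _ => hO) hK (hKO.trans (Set.subset_iUnion (fun _ : Fin 1 => O) 0))
  exact ⟨f 0, (f 0).continuous, h4 0, h1 0, fun x hx => by simpa using h2 hx, h3 0⟩

lemma chartMeasure_restrict_eq_self {d k : ℕ} {U : Set (EuclideanSpace ℝ (Fin k))} (hU : IsOpen U)
    {φ : EuclideanSpace ℝ (Fin k) → EuclideanSpace ℝ (Fin d)} (hφ : ContDiffOn ℝ 2 φ U)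
    {B : Set (EuclideanSpace ℝ (Fin d))} (hB : MeasurableSet B) (hUB : ∀ u ∈ U, φ u ∈ B) :
    (chartMeasure U φ).restrict B = chartMeasure U φ := by
  refine Measure.restrict_eq_self_of_ae_mem ?_
  rw [chartMeasure, ae_map_iff (p := (· ∈ B)) (aemeasurable_chart hU hφ) hB]
  refine (withDensity_absolutelyContinuous _ _).ae_le ?_
  filter_upwards [ae_restrict_mem hU.measurableSet] with u hu
  exact hUB u hu

/-- Restricting a chart measure to a set `B` gives the measure of a smaller chart. -/
lemma chartMeasure_restrict {d k : ℕ} {U V : Set (EuclideanSpace ℝ (Fin k))} (hU : IsOpen U)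
    {φ ψ : EuclideanSpace ℝ (Fin k) → EuclideanSpace ℝ (Fin d)} (hφ : ContDiffOn ℝ 2 φ U)
    {B : Set (EuclideanSpace ℝ (Fin d))} (hB : MeasurableSet B) (hV : IsOpen V)
    (hUV : φ ⁻¹' B ∩ U = V) (heq : Set.EqOn φ ψ V) :
    (chartMeasure U φ).restrict B = chartMeasure V ψ := by
  rw [chartMeasure, Measure.restrict_map_of_aemeasurable
    (aemeasurable_chart hU hφ) hB, restrict_withDensity',
    Measure.restrict_restrict' hU.measurableSet, hUV, chartMeasure]
  have h1 : ∀ u ∈ V, jacobian φ u = jacobian ψ u := fun u hu => by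
    rw [jacobian_eq_coordMatrix, jacobian_eq_coordMatrix,
      (heq.eventuallyEq_of_mem (hV.mem_nhds hu)).fderiv_eq]
  rw [withDensity_congr_ae (g := fun u =>
    ENNReal.ofReal (Real.sqrt ((jacobian ψ u).transpose * jacobian ψ u).det))]
  · refine Measure.map_congr ((withDensity_absolutelyContinuous _ _).ae_le ?_)
    filter_upwards [ae_restrict_mem hV.measurableSet] with u hu
    exact heq hu
  · filter_upwards [ae_restrict_mem hV.measurableSet] with u hu
    rw [h1 u hu]

lemma measurableSet_levelSet {d n : ℕ} {X : Set (EuclideanSpace ℝ (Fin d))} (hX : IsOpen X)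
    {h : EuclideanSpace ℝ (Fin d) → EuclideanSpace ℝ (Fin n)} (hh : ContinuousOn h X) :
    MeasurableSet (levelSet X h) := by
  have h1 : IsOpen (X ∩ h ⁻¹' {0}ᶜ) := hh.isOpen_inter_preimage hX isOpen_compl_singleton
  have h2 : levelSet X h = X \ (X ∩ h ⁻¹' {0}ᶜ) := by
    ext x; simp [levelSet]
  rw [h2]
  exact hX.measurableSet.diff h1.measurableSet

lemma IsLocalParam.apply_mem {d k : ℕ} {M : Set (EuclideanSpace ℝ (Fin d))}
    {U : Set (EuclideanSpace ℝ (Fin k))}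
    {φ : EuclideanSpace ℝ (Fin k) → EuclideanSpace ℝ (Fin d)} (hφ : IsLocalParam M U φ)
    {u} (hu : u ∈ U) : φ u ∈ M := by
  obtain ⟨W, -, hW⟩ := hφ.image_open U subset_rfl hφ.isOpen
  exact (hW ▸ Set.mem_image_of_mem φ hu : φ u ∈ W ∩ M).2

section
variable {d k n : ℕ} {X : Set (EuclideanSpace ℝ (Fin d))}
  {h : EuclideanSpace ℝ (Fin d) → EuclideanSpace ℝ (Fin n)}
  {G G' : OpenPartialHomeomorph (EuclideanSpace ℝ (Fin k) × EuclideanSpace ℝ (Fin n))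
      (EuclideanSpace ℝ (Fin d))}

/-- The chart measures of two straightenings agree on the overlap, because both are determined by
the limits of the normalized integrals over the fattenings. -/
lemma IsStraightening.chartMeasure_congr (hG : IsStraightening X h G) (hG' : IsStraightening X h G')
    (hX : IsOpen X) (h_smooth : ContDiffOn ℝ 2 h X)
    (h_submersion : ∀ x ∈ X, Function.Surjective (fderiv ℝ h x))
    (σ : Fin d ≃ Fin k ⊕ Fin n) :
    (chartMeasure (zeroSlice G) fun u => G (u, 0)).restrict (G.target ∩ G'.target) =
      (chartMeasure (zeroSlice G') fun u => G' (u, 0)).restrict (G.target ∩ G'.target) := by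
  refine restrict_eq_of_forall_nhds fun x hx => ?_
  obtain ⟨χ, hχc, hχs, hχt, hχ1, hχ01⟩ := exists_cutoff (K := {x}) isCompact_singleton
    (G.open_target.inter G'.open_target) (by simpa using hx)
  have hρ : Continuous fun x => χ x * coareaWeight h x :=
    ContinuousOn.continuous_of_tsupport_subset (s := X)
      (hχc.continuousOn.mul (continuousOn_coareaWeight hX h_smooth h_submersion)) hX
      ((tsupport_mul_subset_left).trans (hχt.trans (Set.inter_subset_left.trans hG.target_subset)))
  have hρ0 : ∀ x, 0 ≤ χ x * coareaWeight h x := fun y => by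
    by_cases hy : y ∈ X
    · exact mul_nonneg (hχ01 y).1 (coareaWeight_pos (h_submersion y hy)).le
    · rw [show χ y = 0 from image_eq_zero_of_notMem_tsupport fun hy' =>
        hy (hG.target_subset (hχt hy').1), zero_mul]
  -- Both sides are limits of the same normalized integrals over the fattenings, computed in two
  -- coordinate systems.
  have hlim : ∀ f : EuclideanSpace ℝ (Fin d) →ᵇ ℝ,
      ∫ x, χ x * f x * coareaWeight h x ∂(chartMeasure (zeroSlice G) fun u => G (u, 0)) =
      ∫ x, χ x * f x * coareaWeight h x ∂(chartMeasure (zeroSlice G') fun u => G' (u, 0)) := by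
    intro f
    have hc : Continuous fun x => χ x * f x := hχc.mul f.continuous
    have hs : HasCompactSupport fun x => χ x * f x := hχs.mul_right
    have ht : tsupport (fun x => χ x * f x) ⊆ G.target ∩ G'.target :=
      (tsupport_mul_subset_left).trans hχt
    exact tendsto_nhds_unique
      (hG.tendsto_fattening_integral hX h_smooth h_submersion σ hc hs
        (ht.trans Set.inter_subset_left)).2
      (hG'.tendsto_fattening_integral hX h_smooth h_submersion σ hc hs
        (ht.trans Set.inter_subset_right)).2
  have i1 := (hG.tendsto_fattening_integral hX h_smooth h_submersion σ hχc hχs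
    (hχt.trans Set.inter_subset_left)).1
  have i2 := (hG'.tendsto_fattening_integral hX h_smooth h_submersion σ hχc hχs
    (hχt.trans Set.inter_subset_right)).1
  have f1 := isFiniteMeasure_withDensity_ofReal i1.2
  have f2 := isFiniteMeasure_withDensity_ofReal i2.2
  have hm : Measurable fun x => ENNReal.ofReal (χ x * coareaWeight h x) :=
    hρ.measurable.ennreal_ofReal
  -- The factor `χ * coareaWeight h` makes both measures finite, so that bounded continuous
  -- functions determine them. It is nonzero near `x` and can therefore be removed there.
  have heq := ext_of_forall_integral_eq_of_IsFiniteMeasure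
    (μ := (chartMeasure (zeroSlice G) fun u => G (u, 0)).withDensity
      fun x => ENNReal.ofReal (χ x * coareaWeight h x))
    (ν := (chartMeasure (zeroSlice G') fun u => G' (u, 0)).withDensity
      fun x => ENNReal.ofReal (χ x * coareaWeight h x)) fun f => by
    rw [integral_withDensity_eq_integral_toReal_smul hm (by simp),
      integral_withDensity_eq_integral_toReal_smul hm (by simp)]
    simp only [ENNReal.toReal_ofReal (hρ0 _), smul_eq_mul]
    simpa only [mul_right_comm] using hlim f
  refine ⟨_, ?_, restrict_eq_of_withDensity_eq hm (by simp) heq⟩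
  have h1 : 0 < χ x * coareaWeight h x := by
    rw [hχ1 x rfl, one_mul]
    exact coareaWeight_pos (h_submersion x (hG.target_subset hx.1))
  filter_upwards [hρ.continuousAt.eventually (lt_mem_nhds h1)] with y hy
  simpa using hy

/-- The straightening is built from `φ` itself, so its zero slice is parametrized by `φ`.
Injectivity of `φ` on all of `U` ensures that no other part of the chart enters `G.target`. -/
lemma IsLocalParam.exists_isStraightening (σ : Fin d ≃ Fin k ⊕ Fin n) (hX : IsOpen X)
    (h_smooth : ContDiffOn ℝ 2 h X)
    (h_submersion : ∀ x ∈ X, Function.Surjective (fderiv ℝ h x))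
    {U : Set (EuclideanSpace ℝ (Fin k))}
    {φ : EuclideanSpace ℝ (Fin k) → EuclideanSpace ℝ (Fin d)}
    (hφ : IsLocalParam (levelSet X h) U φ) {u₀} (hu₀ : u₀ ∈ U) :
    ∃ G : OpenPartialHomeomorph (EuclideanSpace ℝ (Fin k) × EuclideanSpace ℝ (Fin n))
        (EuclideanSpace ℝ (Fin d)),
      IsStraightening X h G ∧ φ u₀ ∈ G.target ∧
      (chartMeasure U φ).restrict G.target = chartMeasure (zeroSlice G) fun u => G (u, 0) := by
  have hmem := hφ.apply_mem hu₀
  have hcd : ContDiffAt ℝ 2 φ u₀ := hφ.contDiffOn.contDiffAt (hφ.isOpen.mem_nhds hu₀)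
  have hcomp : fderiv ℝ h (φ u₀) ∘L fderiv ℝ φ u₀ = 0 := by
    have h1 : HasFDerivAt h (fderiv ℝ h (φ u₀)) (φ u₀) :=
      ((h_smooth.contDiffAt (hX.mem_nhds hmem.1)).differentiableAt (by norm_num)).hasFDerivAt
    have h2 := (h1.comp u₀ (hcd.differentiableAt (by norm_num)).hasFDerivAt).congr_of_eventuallyEq
      (f₁ := fun _ => 0) (by
        filter_upwards [hφ.isOpen.mem_nhds hu₀] with u hu
        exact (hφ.apply_mem hu).2.symm)
    exact h2.unique (hasFDerivAt_const _ _)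
  obtain ⟨G, hG, hG0, hGN, hGφ⟩ := _root_.exists_isStraightening σ hX h_smooth hcd hmem.1 hmem.2
    (h_submersion _ hmem.1) (hφ.immersion u₀ hu₀) hcomp (hφ.isOpen.mem_nhds hu₀)
  have hsl : ∀ u ∈ zeroSlice G, u ∈ U ∧ G (u, 0) = φ u := fun u hu =>
    ⟨hGN _ hu, hGφ u hu (hφ.apply_mem (hGN _ hu)).2⟩
  refine ⟨G, hG, ?_, ?_⟩
  · rw [← (hsl u₀ hG0).2]
    exact G.map_source hG0
  · refine chartMeasure_restrict hφ.isOpen hφ.contDiffOn G.open_target.measurableSet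
      IsStraightening.isOpen_zeroSlice ?_ fun u hu => (hsl u hu).2.symm
    ext u
    constructor
    · rintro ⟨hu, huU⟩
      obtain ⟨⟨v, y⟩, hp, hpu⟩ := (G.image_source_eq_target ▸ hu : φ u ∈ G '' G.source)
      obtain rfl : y = 0 := by
        have := hG.apply_eq_snd _ hp
        rw [hpu, (hφ.apply_mem huU).2] at this
        exact this.symm
      obtain ⟨hvU, hv⟩ := hsl v hp
      rw [← hφ.injOn hvU huU (hv.symm.trans hpu)]
      exact hp
    · intro hu
      obtain ⟨huU, he⟩ := hsl u hu
      refine ⟨?_, huU⟩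
      rw [Set.mem_preimage, ← he]
      exact G.map_source hu

/-- On `φ '' U` the two measures agree locally, by passing through a straightening built from `φ`.
Only an inequality remains, as `φ '' U` need not contain all of `M ∩ G.target`. -/
lemma IsLocalParam.chartMeasure_restrict_le (σ : Fin d ≃ Fin k ⊕ Fin n) (hX : IsOpen X)
    (h_smooth : ContDiffOn ℝ 2 h X)
    (h_submersion : ∀ x ∈ X, Function.Surjective (fderiv ℝ h x))
    {U : Set (EuclideanSpace ℝ (Fin k))}
    {φ : EuclideanSpace ℝ (Fin k) → EuclideanSpace ℝ (Fin d)}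
    (hφ : IsLocalParam (levelSet X h) U φ) (hG : IsStraightening X h G) :
    (chartMeasure U φ).restrict G.target ≤ chartMeasure (zeroSlice G) fun u => G (u, 0) := by
  obtain ⟨W, hWo, hW⟩ := hφ.image_open U subset_rfl hφ.isOpen
  have hmeas : MeasurableSet (φ '' U) :=
    hW ▸ hWo.measurableSet.inter (measurableSet_levelSet hX h_smooth.continuousOn)
  have h1 : (chartMeasure U φ).restrict (G.target ∩ φ '' U) =
      (chartMeasure (zeroSlice G) fun u => G (u, 0)).restrict (G.target ∩ φ '' U) := by
    refine restrict_eq_of_forall_nhds ?_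
    rintro _ ⟨hxG, u₀, hu₀, rfl⟩
    obtain ⟨G', hG', hxG', hr⟩ := hφ.exists_isStraightening σ hX h_smooth h_submersion hu₀
    refine ⟨G.target ∩ G'.target, (G.open_target.inter G'.open_target).mem_nhds ⟨hxG, hxG'⟩, ?_⟩
    rw [hG.chartMeasure_congr hG' hX h_smooth h_submersion σ, ← hr, Measure.restrict_restrict
      (G.open_target.inter G'.open_target).measurableSet, Set.inter_assoc, Set.inter_self]
  rw [← chartMeasure_restrict_eq_self hφ.isOpen hφ.contDiffOn hmeas
    fun u hu => Set.mem_image_of_mem φ hu, Measure.restrict_restrict G.open_target.measurableSet, h1]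
  exact Measure.restrict_le_self

/-- On the domain of a straightening, the Riemannian measure is the chart measure. -/
lemma IsStraightening.riemannianMeasure_restrict (hG : IsStraightening X h G)
    (σ : Fin d ≃ Fin k ⊕ Fin n) (hX : IsOpen X) (h_smooth : ContDiffOn ℝ 2 h X)
    (h_submersion : ∀ x ∈ X, Function.Surjective (fderiv ℝ h x)) :
    (riemannianMeasure k (levelSet X h)).restrict G.target =
      chartMeasure (zeroSlice G) fun u => G (u, 0) := by
  have hT := G.open_target.measurableSet
  have hle : ∀ U φ, IsLocalParam (levelSet X h) U φ →
      chartMeasure U φ ≤ riemannianMeasure k (levelSet X h) := fun U φ hφ =>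
    le_iSup_of_le U (le_iSup_of_le φ (le_iSup_of_le hφ le_rfl))
  apply le_antisymm
  -- The bound is checked on each chart measure, split into its parts inside and outside `G.target`.
  -- Restricting it to `G.target` removes the second summand.
  · have h1 : riemannianMeasure k (levelSet X h) ≤ (chartMeasure (zeroSlice G) fun u => G (u, 0)) +
        (riemannianMeasure k (levelSet X h)).restrict G.targetᶜ := by
      refine iSup_le fun U => iSup_le fun φ => iSup_le fun hφ => ?_
      rw [← Measure.restrict_add_restrict_compl (μ := chartMeasure U φ) hT]
      exact add_le_add (hφ.chartMeasure_restrict_le σ hX h_smooth h_submersion hG)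
        (Measure.restrict_mono subset_rfl (hle U φ hφ))
    refine (Measure.restrict_mono subset_rfl h1).trans ?_
    rw [Measure.restrict_add, Measure.restrict_restrict hT, Set.inter_compl_self,
      Measure.restrict_empty, add_zero]
    exact Measure.restrict_le_self
  · rw [← chartMeasure_restrict_eq_self IsStraightening.isOpen_zeroSlice hG.contDiffOn_slice hT
      fun u hu => G.map_source hu]
    exact Measure.restrict_mono subset_rfl (hle _ _ hG.isLocalParam)

lemma riemannianMeasure_restrict_levelSet (k : ℕ) (hX : IsOpen X) (hh : ContinuousOn h X) :
    (riemannianMeasure k (levelSet X h)).restrict (levelSet X h) =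
      riemannianMeasure k (levelSet X h) := by
  refine le_antisymm Measure.restrict_le_self ?_
  conv_lhs => rw [riemannianMeasure]
  refine iSup_le fun U => iSup_le fun φ => iSup_le fun hφ => ?_
  rw [← chartMeasure_restrict_eq_self hφ.isOpen hφ.contDiffOn (measurableSet_levelSet hX hh)
    fun u hu => hφ.apply_mem hu]
  exact Measure.restrict_mono subset_rfl
    (le_iSup_of_le U (le_iSup_of_le φ (le_iSup_of_le hφ le_rfl)))

/-- Every point of the zero set lies in the domain of a straightening. -/
lemma exists_isStraightening_of_mem_levelSet (σ : Fin d ≃ Fin k ⊕ Fin n) (hX : IsOpen X)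
    (h_smooth : ContDiffOn ℝ 2 h X)
    (h_submersion : ∀ x ∈ X, Function.Surjective (fderiv ℝ h x))
    {x : EuclideanSpace ℝ (Fin d)} (hx : x ∈ levelSet X h) :
    ∃ G : OpenPartialHomeomorph (EuclideanSpace ℝ (Fin k) × EuclideanSpace ℝ (Fin n))
        (EuclideanSpace ℝ (Fin d)), IsStraightening X h G ∧ x ∈ G.target := by
  set A := fderiv ℝ h x with hA
  have hdim : Module.finrank ℝ (EuclideanSpace ℝ (Fin k)) =
      Module.finrank ℝ (LinearMap.ker A.toLinearMap) := by
    have h1 := A.toLinearMap.finrank_range_add_finrank_ker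
    rw [LinearMap.range_eq_top.2 (h_submersion x hx.1), finrank_top] at h1
    have h2 := (splitCoords σ).toLinearEquiv.finrank_eq
    simp only [Module.finrank_prod, finrank_euclideanSpace_fin] at h1 h2 ⊢
    omega
  let e := LinearEquiv.ofFinrankEq (EuclideanSpace ℝ (Fin k)) (LinearMap.ker A.toLinearMap) hdim
  -- The affine tangent space `x + P u` suffices as initial immersion. It need not stay in `M`, but
  -- agreement with `G` is needed only at `u = 0`.
  let P : EuclideanSpace ℝ (Fin k) →L[ℝ] EuclideanSpace ℝ (Fin d) :=
    ((LinearMap.ker A.toLinearMap).subtype ∘ₗ e.toLinearMap).toContinuousLinearMap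
  have hPinj : Function.Injective P := Subtype.val_injective.comp e.injective
  have hAP : A ∘L P = 0 := by
    ext1 u
    exact (e u).2
  have hd : ∀ u, HasFDerivAt (fun u => x + P u) P u := fun u => P.hasFDerivAt.const_add x
  have h0 : x + P 0 = x := by simp
  obtain ⟨G, hG, hG0, -, hGφ⟩ := exists_isStraightening σ hX h_smooth
    (φ := fun u => x + P u) (u₀ := 0) (contDiff_const.add P.contDiff).contDiffAt
    (by simpa using hx.1) (by simpa using hx.2) (by simpa using h_submersion x hx.1)
    (by rw [(hd 0).fderiv]; exact hPinj) (by rw [(hd 0).fderiv, h0]; exact hAP) univ_mem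
  refine ⟨G, hG, ?_⟩
  have := hGφ 0 hG0 (by simpa using hx.2)
  rw [h0] at this
  rw [← this]
  exact G.map_source hG0

/-! ### The limit formula for compactly supported functions -/

/-- The limit formula for the normalized integrals over the fattenings of the zero set. -/
theorem tendsto_fattening_integral (σ : Fin d ≃ Fin k ⊕ Fin n) (hX : IsOpen X)
    (h_smooth : ContDiffOn ℝ 2 h X)
    (h_submersion : ∀ x ∈ X, Function.Surjective (fderiv ℝ h x))
    {g : EuclideanSpace ℝ (Fin d) → ℝ} (hg : Continuous g)
    (hgc : HasCompactSupport g) (hgX : tsupport g ⊆ X) :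
    Integrable (fun x => g x * coareaWeight h x) (riemannianMeasure k (levelSet X h)) ∧
    Tendsto (fun ε => (ballVolume n ε)⁻¹ * ∫ x in fattening X h ε, g x) (𝓝[>] 0)
      (𝓝 (∫ x, g x * coareaWeight h x ∂(riemannianMeasure k (levelSet X h)))) := by
  have hloc : ∀ x ∈ X, ∃ O, IsOpen O ∧ x ∈ O ∧ ∀ f : EuclideanSpace ℝ (Fin d) → ℝ,
      Continuous f → HasCompactSupport f → tsupport f ⊆ O →
      Integrable (fun x => f x * coareaWeight h x) (riemannianMeasure k (levelSet X h)) ∧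
      Tendsto (fun ε => (ballVolume n ε)⁻¹ * ∫ x in fattening X h ε, f x) (𝓝[>] 0)
        (𝓝 (∫ x, f x * coareaWeight h x ∂(riemannianMeasure k (levelSet X h)))) := by
    intro x hx
    by_cases hx0 : h x = 0
    · obtain ⟨G, hG, hxG⟩ := exists_isStraightening_of_mem_levelSet σ hX h_smooth h_submersion
        (x := x) ⟨hx, hx0⟩
      refine ⟨G.target, G.open_target, hxG, fun f hf hfc hfG => ?_⟩
      have hz : ∀ y ∉ G.target, f y * coareaWeight h y = 0 := fun y hy => by
        rw [image_eq_zero_of_notMem_tsupport fun hy' => hy (hfG hy'), zero_mul]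
      have := hG.tendsto_fattening_integral hX h_smooth h_submersion σ hf hfc hfG
      rw [← hG.riemannianMeasure_restrict σ hX h_smooth h_submersion,
        setIntegral_eq_integral_of_forall_compl_eq_zero hz] at this
      exact ⟨(integrableOn_iff_integrable_of_support_subset fun y hy => by
        by_contra hy'; exact hy (hz y hy')).1 this.1, this.2⟩
    -- Away from `M` both sides vanish: `‖h‖` has a positive lower bound on the compact support, so
    -- small fattenings miss it.
    · refine ⟨X ∩ h ⁻¹' {0}ᶜ, h_smooth.continuousOn.isOpen_inter_preimage hX
        isOpen_compl_singleton, ⟨hx, hx0⟩, fun f hf hfc hfO => ?_⟩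
      have hz : (fun x => f x * coareaWeight h x) =ᵐ[riemannianMeasure k (levelSet X h)] 0 := by
        rw [← riemannianMeasure_restrict_levelSet k hX h_smooth.continuousOn]
        filter_upwards [ae_restrict_mem (measurableSet_levelSet hX h_smooth.continuousOn)] with y hy
        rw [image_eq_zero_of_notMem_tsupport fun hy' => (hfO hy').2 hy.2, zero_mul]
        rfl
      refine ⟨(integrable_zero _ _ _).congr hz.symm, ?_⟩
      rw [integral_congr_ae hz]
      simp only [Pi.zero_apply, integral_zero]
      refine tendsto_const_nhds.congr' ?_
      obtain ⟨c, hc, hcb⟩ : ∃ c > 0, ∀ y ∈ tsupport f, c ≤ ‖h y‖ := by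
        rcases (tsupport f).eq_empty_or_nonempty with he | hne
        · exact ⟨1, one_pos, by simp [he]⟩
        · obtain ⟨y, hy, hmin⟩ := hfc.isCompact.exists_isMinOn hne
            (h_smooth.continuousOn.norm.mono (hfO.trans Set.inter_subset_left))
          exact ⟨‖h y‖, norm_pos_iff.2 (hfO hy).2, fun z hz => hmin hz⟩
      filter_upwards [Ioo_mem_nhdsGT hc] with ε hε
      rw [setIntegral_eq_zero_of_forall_eq_zero, mul_zero]
      intro y hy
      by_contra h0
      exact absurd (hcb y (subset_tsupport f h0)) (not_le.2 (hy.2.trans_lt hε.2))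
  choose! O hO hxO hloc using hloc
  obtain ⟨t, hcov⟩ := hgc.isCompact.elim_nhds_subcover' (fun x _ => O x)
    fun x hx => (hO x (hgX hx)).mem_nhds (hxO x (hgX hx))
  -- A partition of unity on the support of `g` subordinate to finitely many of the sets `O x`. Both
  -- sides of the formula are additive in `g`.
  obtain ⟨f, hft, hf1, -, -⟩ := exists_continuous_sum_one_of_isOpen_isCompact (n := t.card)
    (s := fun i => O (t.equivFin.symm i).1) (fun i => hO _ (hgX (t.equivFin.symm i).1.2))
    hgc.isCompact (fun y hy => by
      obtain ⟨x, hx, hyx⟩ := Set.mem_iUnion₂.1 (hcov hy)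
      exact Set.mem_iUnion.2 ⟨t.equivFin ⟨x, hx⟩, by simpa using hyx⟩)
  have hsum : ∀ y, g y = ∑ i, f i y * g y := fun y => by
    by_cases hy : y ∈ tsupport g
    · have := hf1 hy
      rw [Finset.sum_apply, Pi.one_apply] at this
      rw [← Finset.sum_mul, this, one_mul]
    · simp [image_eq_zero_of_notMem_tsupport hy]
  have hcont : ∀ i, Continuous fun y => f i y * g y := fun i => (f i).continuous.mul hg
  have hsupp : ∀ i, HasCompactSupport fun y => f i y * g y := fun i => hgc.mul_left
  have hfi := fun i => hloc _ (hgX (t.equivFin.symm i).1.2) (fun y => f i y * g y) (hcont i)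
    (hsupp i) ((tsupport_mul_subset_left).trans (hft i))
  have hgw : (fun x => g x * coareaWeight h x) =
      fun x => ∑ i, f i x * g x * coareaWeight h x := by
    ext x
    rw [← Finset.sum_mul, ← hsum]
  refine ⟨?_, ?_⟩
  · rw [hgw]
    exact integrable_finsetSum _ fun i _ => (hfi i).1
  · rw [hgw, integral_finsetSum _ fun i _ => (hfi i).1]
    refine (tendsto_finsetSum _ fun i _ => (hfi i).2).congr fun ε => ?_
    rw [← Finset.mul_sum, ← integral_finsetSum _ fun i _ =>
      ((hcont i).integrable_of_hasCompactSupport (hsupp i)).integrableOn]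
    simp_rw [← hsum]

end

/-! ### The normalized laws as measures on the subspace -/

/-- Normalizing a density and restricting to a subspace that carries the measure. -/
lemma isProbabilityMeasure_comap_withDensity {α : Type*} [MeasurableSpace α] {X : Set α}
    (hX : MeasurableSet X) {μ : Measure α} (hμ : ∀ᵐ x ∂μ, x ∈ X) {ρ : α → ℝ} {c : ℝ≥0∞}
    (hc : ∫⁻ x, ENNReal.ofReal (ρ x) ∂μ = c) (hc0 : c ≠ 0) (hct : c ≠ ∞) :
    IsProbabilityMeasure
      ((c⁻¹ • μ.withDensity fun x => ENNReal.ofReal (ρ x)).comap (Subtype.val : X → α)) := by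
  constructor
  rw [(MeasurableEmbedding.subtype_coe hX).comap_apply, Set.image_univ, Subtype.range_coe,
    Measure.smul_apply, withDensity_apply _ hX, Measure.restrict_eq_self_of_ae_mem hμ, hc,
    smul_eq_mul, ENNReal.inv_mul_cancel hc0 hct]

lemma integral_comap_withDensity {α : Type*} [MeasurableSpace α] {X : Set α}
    (hX : MeasurableSet X) {μ : Measure α} (hμ : ∀ᵐ x ∂μ, x ∈ X) {ρ : α → ℝ}
    (hρ : AEMeasurable ρ μ) (hρ0 : 0 ≤ᵐ[μ] ρ) {c : ℝ≥0∞}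
    (hc : ∫⁻ x, ENNReal.ofReal (ρ x) ∂μ = c) (b : α → ℝ) :
    ∫ x : X, b x ∂((c⁻¹ • μ.withDensity fun x => ENNReal.ofReal (ρ x)).comap Subtype.val) =
      (∫ x, ρ x ∂μ)⁻¹ * ∫ x, b x * ρ x ∂μ := by
  have hμ' : ∀ᵐ x ∂(c⁻¹ • μ.withDensity fun x => ENNReal.ofReal (ρ x)), x ∈ X :=
    Measure.ae_smul_measure ((withDensity_absolutelyContinuous _ _).ae_le hμ) _
  rw [integral_subtype_comap hX, Measure.restrict_eq_self_of_ae_mem hμ', integral_smul_measure,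
    integral_withDensity_eq_integral_toReal_smul₀ hρ.ennreal_ofReal (by simp),
    integral_eq_lintegral_of_nonneg_ae hρ0 hρ.aestronglyMeasurable, hc, ENNReal.toReal_inv,
    smul_eq_mul]
  congr 1
  refine integral_congr_ae ?_
  filter_upwards [hρ0] with x hx
  rw [ENNReal.toReal_ofReal hx, smul_eq_mul, mul_comm]

lemma measurableSet_fattening {d n : ℕ} {X : Set (EuclideanSpace ℝ (Fin d))} (hX : IsOpen X)
    {h : EuclideanSpace ℝ (Fin d) → EuclideanSpace ℝ (Fin n)} (hh : ContinuousOn h X) (ε : ℝ) :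
    MeasurableSet (fattening X h ε) := by
  have h1 : IsOpen (X ∩ h ⁻¹' (Metric.closedBall 0 ε)ᶜ) :=
    hh.isOpen_inter_preimage hX Metric.isClosed_closedBall.isOpen_compl
  have h2 : fattening X h ε = X \ (X ∩ h ⁻¹' (Metric.closedBall 0 ε)ᶜ) := by
    ext x; simp [fattening]
  rw [h2]
  exact hX.measurableSet.diff h1.measurableSet

lemma truncatedLaw_eq {d n : ℕ} {X : Set (EuclideanSpace ℝ (Fin d))} (hX : IsOpen X)
    {h : EuclideanSpace ℝ (Fin d) → EuclideanSpace ℝ (Fin n)} (hh : ContinuousOn h X)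
    (a : EuclideanSpace ℝ (Fin d) → ℝ) {ε : ℝ} (hm : fatteningMass X h a ε ≠ 0) :
    truncatedLaw X h a ε = ((fatteningMass X h a ε)⁻¹ •
      (volume.restrict (fattening X h ε)).withDensity fun x => ENNReal.ofReal (a x)).comap
        Subtype.val := by
  rw [truncatedLaw, ← withDensity_indicator (measurableSet_fattening hX hh ε),
    ← withDensity_smul' _ _ (ENNReal.inv_ne_top.2 hm)]
  congr 2
  ext x
  rw [ENNReal.div_eq_inv_mul]
  rfl

lemma limitLaw_eq {d n : ℕ} {X : Set (EuclideanSpace ℝ (Fin d))}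
    {h : EuclideanSpace ℝ (Fin d) → EuclideanSpace ℝ (Fin n)}
    (a : EuclideanSpace ℝ (Fin d) → ℝ) (hm : limitMass X h a ≠ 0) :
    limitLaw X h a = ((limitMass X h a)⁻¹ •
      (riemannianMeasure (d - n) (levelSet X h)).withDensity
        fun x => ENNReal.ofReal (a x * coareaWeight h x)).comap Subtype.val := by
  rw [limitLaw, ← withDensity_smul' _ _ (ENNReal.inv_ne_top.2 hm)]
  congr 2
  ext x
  rw [ENNReal.div_eq_inv_mul]
  rfl

/-! ### Tightness and bounded continuous functions -/

section
variable {d k n : ℕ} {X : Set (EuclideanSpace ℝ (Fin d))}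
  {h : EuclideanSpace ℝ (Fin d) → EuclideanSpace ℝ (Fin n)}

lemma ae_mem_levelSet (k : ℕ) (hX : IsOpen X) (hh : ContinuousOn h X) :
    ∀ᵐ x ∂(riemannianMeasure k (levelSet X h)), x ∈ levelSet X h := by
  rw [← riemannianMeasure_restrict_levelSet k hX hh]
  exact ae_restrict_mem (measurableSet_levelSet hX hh)

lemma aemeasurable_riemannianMeasure (k : ℕ) (hX : IsOpen X) (hh : ContinuousOn h X)
    {c : EuclideanSpace ℝ (Fin d) → ℝ} (hc : ContinuousOn c X) :
    AEMeasurable c (riemannianMeasure k (levelSet X h)) := by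
  rw [← riemannianMeasure_restrict_levelSet k hX hh]
  exact (hc.mono fun x hx => hx.1).aemeasurable (measurableSet_levelSet hX hh)

/-- The function `c` is controlled only on `X`. Multiplication by the cutoff makes it continuous on
the whole space. -/
lemma tendsto_fattening_integral_cutoff (σ : Fin d ≃ Fin k ⊕ Fin n) (hX : IsOpen X)
    (h_smooth : ContDiffOn ℝ 2 h X)
    (h_submersion : ∀ x ∈ X, Function.Surjective (fderiv ℝ h x))
    {c χ : EuclideanSpace ℝ (Fin d) → ℝ} (hc : ContinuousOn c X) (hχ : Continuous χ)
    (hχc : HasCompactSupport χ) (hχX : tsupport χ ⊆ X) :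
    Integrable (fun x => χ x * c x * coareaWeight h x) (riemannianMeasure k (levelSet X h)) ∧
    Tendsto (fun ε => (ballVolume n ε)⁻¹ * ∫ x in fattening X h ε, χ x * c x) (𝓝[>] 0)
      (𝓝 (∫ x, χ x * c x * coareaWeight h x ∂(riemannianMeasure k (levelSet X h)))) :=
  tendsto_fattening_integral σ hX h_smooth h_submersion
    (ContinuousOn.continuous_of_tsupport_subset (hχ.continuousOn.mul hc) hX
      ((tsupport_mul_subset_left).trans hχX)) hχc.mul_right ((tsupport_mul_subset_left).trans hχX)

/-- An upper bound for the cut off integrals of `c` over the zero set is one for its integral. -/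
lemma lintegral_le_of_cutoff (σ : Fin d ≃ Fin k ⊕ Fin n) (hX : IsOpen X)
    (h_smooth : ContDiffOn ℝ 2 h X)
    (h_submersion : ∀ x ∈ X, Function.Surjective (fderiv ℝ h x))
    {c : EuclideanSpace ℝ (Fin d) → ℝ} (hc : ContinuousOn c X) (hc0 : ∀ x ∈ X, 0 ≤ c x) {R : ℝ}
    (hR : ∀ χ : EuclideanSpace ℝ (Fin d) → ℝ, Continuous χ → HasCompactSupport χ →
      tsupport χ ⊆ X → (∀ x, χ x ∈ Set.Icc (0 : ℝ) 1) →
      ∫ x, χ x * c x * coareaWeight h x ∂(riemannianMeasure k (levelSet X h)) ≤ R) :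
    ∫⁻ x, ENNReal.ofReal (c x * coareaWeight h x) ∂(riemannianMeasure k (levelSet X h)) ≤
      ENNReal.ofReal R := by
  have hae : ∀ᵐ x ∂(riemannianMeasure k (levelSet X h)), x ∈ X :=
    (ae_mem_levelSet k hX h_smooth.continuousOn).mono fun x hx => hx.1
  -- Monotone convergence along a compact exhaustion of `X`, with a cutoff equal to `1` on each
  -- compact set.
  obtain ⟨K, hKc, hKX⟩ : IsSigmaCompact X := by
    have : SigmaCompactSpace X := by
      have : LocallyCompactSpace X := hX.locallyCompactSpace
      infer_instance
    exact isSigmaCompact_iff_sigmaCompactSpace.2 this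
  have hKX' : ⋃ i, Set.accumulate K i = X := by rw [Set.iUnion_accumulate, hKX]
  have h0 : ∫⁻ x, ENNReal.ofReal (c x * coareaWeight h x) ∂(riemannianMeasure k (levelSet X h)) =
      ∫⁻ x in ⋃ i, Set.accumulate K i, ENNReal.ofReal (c x * coareaWeight h x)
        ∂(riemannianMeasure k (levelSet X h)) := by
    rw [hKX', Measure.restrict_eq_self_of_ae_mem hae]
  rw [h0, setLIntegral_iUnion_of_directed _ (Set.monotone_accumulate.directed_le)]
  refine iSup_le fun i => ?_
  have hKi : IsCompact (Set.accumulate K i) := isCompact_accumulate hKc i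
  obtain ⟨χ, h1, h2, h3, h4, h5⟩ := exists_cutoff hKi hX
    ((Set.subset_iUnion (Set.accumulate K) i).trans hKX'.subset)
  have hint := (tendsto_fattening_integral_cutoff σ hX h_smooth h_submersion hc h1 h2 h3).1
  calc ∫⁻ x in Set.accumulate K i, ENNReal.ofReal (c x * coareaWeight h x)
        ∂(riemannianMeasure k (levelSet X h))
      = ∫⁻ x in Set.accumulate K i, ENNReal.ofReal (χ x * c x * coareaWeight h x)
        ∂(riemannianMeasure k (levelSet X h)) :=
        setLIntegral_congr_fun hKi.measurableSet fun x hx => by rw [h4 x hx, one_mul]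
    _ ≤ ∫⁻ x, ENNReal.ofReal (χ x * c x * coareaWeight h x)
        ∂(riemannianMeasure k (levelSet X h)) := setLIntegral_le_lintegral _ _
    _ = ENNReal.ofReal (∫ x, χ x * c x * coareaWeight h x
        ∂(riemannianMeasure k (levelSet X h))) := by
        refine (ofReal_integral_eq_lintegral_ofReal hint ?_).symm
        filter_upwards [hae] with x hx
        exact mul_nonneg (mul_nonneg (h5 x).1 (hc0 x hx)) (coareaWeight_pos (h_submersion x hx)).le
    _ ≤ ENNReal.ofReal R := ENNReal.ofReal_le_ofReal (hR χ h1 h2 h3 h5)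

/-- If the weights `a` on the fattenings are tight, then the limit formula for their normalized
integrals holds for all bounded continuous functions. -/
theorem tendsto_fattening_integral_of_tight (σ : Fin d ≃ Fin k ⊕ Fin n) (hX : IsOpen X)
    (h_smooth : ContDiffOn ℝ 2 h X)
    (h_submersion : ∀ x ∈ X, Function.Surjective (fderiv ℝ h x))
    {a : EuclideanSpace ℝ (Fin d) → ℝ} (a_nonneg : ∀ x ∈ X, 0 ≤ a x) (a_cont : ContinuousOn a X)
    (a_int : ∀ ε, 0 < ε → IntegrableOn a (fattening X h ε))
    (tight : ∀ δ, 0 < δ → ∃ χ : EuclideanSpace ℝ (Fin d) → ℝ, Continuous χ ∧ HasCompactSupport χ ∧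
      tsupport χ ⊆ X ∧ (∀ x, χ x ∈ Set.Icc (0 : ℝ) 1) ∧ ∀ ε, 0 < ε →
        ∫ x in fattening X h ε, (1 - χ x) * a x ≤ δ * ∫ x in fattening X h ε, a x) :
    Integrable (fun x => a x * coareaWeight h x) (riemannianMeasure k (levelSet X h)) ∧
    ∀ (b : EuclideanSpace ℝ (Fin d) → ℝ) (C : ℝ), ContinuousOn b X → (∀ x ∈ X, |b x| ≤ C) →
      Tendsto (fun ε => (ballVolume n ε)⁻¹ * ∫ x in fattening X h ε, b x * a x) (𝓝[>] 0)
        (𝓝 (∫ x, b x * a x * coareaWeight h x ∂(riemannianMeasure k (levelSet X h)))) := by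
  set lam := riemannianMeasure k (levelSet X h) with hlam
  have hae : ∀ᵐ x ∂lam, x ∈ X :=
    (ae_mem_levelSet k hX h_smooth.continuousOn).mono fun x hx => hx.1
  have hw := continuousOn_coareaWeight hX h_smooth h_submersion
  have hfm := measurableSet_fattening hX h_smooth.continuousOn
  have hint : ∀ (c : EuclideanSpace ℝ (Fin d) → ℝ) (C : ℝ), ContinuousOn c X →
      (∀ x ∈ X, |c x| ≤ C) → ∀ ε, 0 < ε →
      IntegrableOn (fun x => c x * a x) (fattening X h ε) := by
    intro c C hc hcC ε hε
    refine ((a_int ε hε).const_mul C).mono'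
      (((hc.mul a_cont).mono fun x hx => hx.1).aestronglyMeasurable (hfm ε)) ?_
    filter_upwards [ae_restrict_mem (hfm ε)] with x hx
    rw [Real.norm_eq_abs, abs_mul, abs_of_nonneg (a_nonneg x hx.1)]
    exact mul_le_mul_of_nonneg_right (hcC x hx.1) (a_nonneg x hx.1)
  have hbd : ∀ {χ : EuclideanSpace ℝ (Fin d) → ℝ}, (∀ x, χ x ∈ Set.Icc (0 : ℝ) 1) →
      ∀ x ∈ X, |χ x| ≤ 1 := fun hχ x _ => abs_le.2 ⟨by linarith [(hχ x).1], (hχ x).2⟩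
  have hv : ∀ ε : ℝ, 0 ≤ (ballVolume n ε)⁻¹ := fun ε => inv_nonneg.2 measureReal_nonneg
  -- With `δ = 1 / 2`, the mass of `a` is at most twice its cut off mass, whose normalization
  -- converges. The maximum with `1` keeps `B` positive, since `δ` below is obtained by dividing by
  -- it.
  obtain ⟨B, hB0, hB⟩ : ∃ B : ℝ, 0 < B ∧ ∀ᶠ ε in 𝓝[>] 0,
      (ballVolume n ε)⁻¹ * ∫ x in fattening X h ε, a x ≤ B := by
    obtain ⟨χ, h1, h2, h3, h4, h5⟩ := tight (1 / 2) (by norm_num)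
    have hT := (tendsto_fattening_integral_cutoff σ hX h_smooth h_submersion a_cont h1 h2 h3).2
    refine ⟨max 1 (2 * (∫ x, χ x * a x * coareaWeight h x ∂lam + 1)), by positivity, ?_⟩
    filter_upwards [hT.eventually (gt_mem_nhds (lt_add_one _)), self_mem_nhdsWithin] with ε hε hε0
    refine le_trans ?_ (le_max_right _ _)
    have h6 := h5 ε hε0
    have h7 : ∫ x in fattening X h ε, (1 - χ x) * a x =
        (∫ x in fattening X h ε, a x) - ∫ x in fattening X h ε, χ x * a x := by
      rw [← integral_sub (a_int ε hε0) (hint χ 1 h1.continuousOn (hbd h4) ε hε0)]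
      congr 1; ext x; ring
    rw [h7] at h6
    have h8 : ∫ x in fattening X h ε, a x ≤ 2 * ∫ x in fattening X h ε, χ x * a x := by linarith
    have h9 := mul_le_mul_of_nonneg_left h8 (hv ε)
    rw [mul_left_comm] at h9
    linarith
  -- Bounds on the normalized fattening integrals pass to the limit measure, even without compact
  -- support. This is used with `θ = 1` for integrability and with `θ = 1 - χ` for the tail.
  have hupper : ∀ (θ : EuclideanSpace ℝ (Fin d) → ℝ) (R : ℝ), ContinuousOn θ X →
      (∀ x, θ x ∈ Set.Icc (0 : ℝ) 1) →
      (∀ᶠ ε in 𝓝[>] 0, (ballVolume n ε)⁻¹ * ∫ x in fattening X h ε, θ x * a x ≤ R) →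
      ∫⁻ x, ENNReal.ofReal (θ x * a x * coareaWeight h x) ∂lam ≤ ENNReal.ofReal R := by
    intro θ R hθ hθ01 hR
    refine lintegral_le_of_cutoff σ hX h_smooth h_submersion
      (c := fun x => θ x * a x) (hθ.mul a_cont)
      (fun x hx => mul_nonneg (hθ01 x).1 (a_nonneg x hx)) fun χ h1 h2 h3 h4 => ?_
    refine le_of_tendsto (tendsto_fattening_integral_cutoff σ hX h_smooth h_submersion
      (c := fun x => θ x * a x) (hθ.mul a_cont) h1 h2 h3).2 ?_
    filter_upwards [hR, self_mem_nhdsWithin] with ε hε hε0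
    refine le_trans (mul_le_mul_of_nonneg_left ?_ (hv ε)) hε
    refine setIntegral_mono_on ?_ (hint θ 1 hθ (hbd hθ01) ε hε0) (hfm ε) fun x hx => ?_
    · have := hint (fun x => χ x * θ x) 1 (h1.continuousOn.mul hθ) (fun x hx => by
        rw [abs_mul]
        exact mul_le_one₀ (hbd h4 x hx) (abs_nonneg _) (hbd hθ01 x hx)) ε hε0
      simpa only [mul_assoc] using this
    · exact mul_le_of_le_one_left (mul_nonneg (hθ01 x).1 (a_nonneg x hx.1)) (h4 x).2
  have haw : Integrable (fun x => a x * coareaWeight h x) lam := by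
    refine ⟨(aemeasurable_riemannianMeasure k hX h_smooth.continuousOn
      (a_cont.mul hw)).aestronglyMeasurable, ?_⟩
    have h1 := hupper (fun _ => 1) B continuousOn_const (by simp) (by simpa using hB)
    simp only [one_mul] at h1
    rw [hasFiniteIntegral_iff_ofReal]
    · exact h1.trans_lt ENNReal.ofReal_lt_top
    · filter_upwards [hae] with x hx
      exact mul_nonneg (a_nonneg x hx) (coareaWeight_pos (h_submersion x hx)).le
  have hint' : ∀ (c : EuclideanSpace ℝ (Fin d) → ℝ) (C : ℝ), ContinuousOn c X →
      (∀ x ∈ X, |c x| ≤ C) → Integrable (fun x => c x * a x * coareaWeight h x) lam := by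
    intro c C hc hcC
    refine (haw.const_mul C).mono' (aemeasurable_riemannianMeasure k hX h_smooth.continuousOn
      ((hc.mul a_cont).mul hw)).aestronglyMeasurable ?_
    filter_upwards [hae] with x hx
    have h1 := mul_nonneg (a_nonneg x hx) (coareaWeight_pos (h_submersion x hx)).le
    rw [Real.norm_eq_abs, mul_assoc, abs_mul, abs_of_nonneg h1]
    exact mul_le_mul_of_nonneg_right (hcC x hx) h1
  refine ⟨haw, fun b C hb hbC => ?_⟩
  rw [Metric.tendsto_nhds]
  intro η hη
  have hC : 0 < |C| + 1 := by positivity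
  -- With this choice, cutting off costs at most `η / 4` both on the fattening and on `M`. The
  -- remaining `η / 2` is spent on the convergence of the cut off integrals. The summand `1` covers
  -- `C = 0`.
  set δ := η / (4 * (|C| + 1) * B) with hδ
  have hδ0 : 0 < δ := by positivity
  have hδ' : (|C| + 1) * (δ * B) = η / 4 := by rw [hδ]; field_simp
  obtain ⟨χ, h1, h2, h3, h4, h5⟩ := tight δ hδ0
  have h1c : ContinuousOn (fun x => 1 - χ x) X := (continuous_const.sub h1).continuousOn
  have h401 : ∀ x, 1 - χ x ∈ Set.Icc (0 : ℝ) 1 := fun x =>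
    ⟨by linarith [(h4 x).2], by linarith [(h4 x).1]⟩
  have hsmall : ∀ᶠ ε in 𝓝[>] 0,
      (ballVolume n ε)⁻¹ * ∫ x in fattening X h ε, (1 - χ x) * a x ≤ δ * B := by
    filter_upwards [hB, self_mem_nhdsWithin] with ε hε hε0
    calc _ ≤ (ballVolume n ε)⁻¹ * (δ * ∫ x in fattening X h ε, a x) :=
          mul_le_mul_of_nonneg_left (h5 ε hε0) (hv ε)
      _ = δ * ((ballVolume n ε)⁻¹ * ∫ x in fattening X h ε, a x) := by ring
      _ ≤ δ * B := mul_le_mul_of_nonneg_left hε hδ0.le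
  have hpt : ∀ x ∈ X, |b x * a x - χ x * (b x * a x)| ≤ (|C| + 1) * ((1 - χ x) * a x) := by
    intro x hx
    rw [show b x * a x - χ x * (b x * a x) = b x * ((1 - χ x) * a x) by ring, abs_mul,
      abs_of_nonneg (mul_nonneg (h401 x).1 (a_nonneg x hx))]
    exact mul_le_mul_of_nonneg_right ((hbC x hx).trans (by linarith [le_abs_self C]))
      (mul_nonneg (h401 x).1 (a_nonneg x hx))
  have hbχ : ∀ x ∈ X, |χ x * b x| ≤ |C| := fun x hx => by
    rw [abs_mul]
    exact (mul_le_of_le_one_left (abs_nonneg _) (hbd h4 x hx)).trans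
      ((hbC x hx).trans (le_abs_self C))
  have hlim0 : |∫ x, b x * a x * coareaWeight h x ∂lam -
      ∫ x, χ x * (b x * a x) * coareaWeight h x ∂lam| ≤ η / 4 := by
    have i2 := hint' (fun x => χ x * b x) |C| (h1.continuousOn.mul hb) hbχ
    simp only [mul_assoc (χ _) (b _) (a _)] at i2
    have i3 := hint' (fun x => 1 - χ x) 1 h1c (hbd h401)
    rw [← integral_sub (hint' b C hb hbC) i2, ← hδ', ← Real.norm_eq_abs]
    calc _ ≤ ∫ x, (|C| + 1) * ((1 - χ x) * a x * coareaWeight h x) ∂lam := by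
          refine norm_integral_le_of_norm_le (i3.const_mul _) ?_
          filter_upwards [hae] with x hx
          rw [← sub_mul, Real.norm_eq_abs, abs_mul,
            abs_of_nonneg (coareaWeight_pos (h_submersion x hx)).le,
            ← mul_assoc (|C| + 1)]
          exact mul_le_mul_of_nonneg_right (hpt x hx) (coareaWeight_pos (h_submersion x hx)).le
      _ ≤ _ := by
          rw [integral_const_mul]
          refine mul_le_mul_of_nonneg_left ?_ hC.le
          rw [integral_eq_lintegral_of_nonneg_ae _ i3.1]
          · exact ENNReal.toReal_le_of_le_ofReal (by positivity)
              (hupper (fun x => 1 - χ x) _ h1c h401 hsmall)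
          · filter_upwards [hae] with x hx
            exact mul_nonneg (mul_nonneg (h401 x).1 (a_nonneg x hx))
              (coareaWeight_pos (h_submersion x hx)).le
  have hT := (tendsto_fattening_integral_cutoff σ hX h_smooth h_submersion
    (c := fun x => b x * a x) (hb.mul a_cont) h1 h2 h3).2
  filter_upwards [hsmall, self_mem_nhdsWithin,
    Metric.tendsto_nhds.1 hT (η / 2) (by positivity)] with ε hε hε0 hεT
  have hclose : |(ballVolume n ε)⁻¹ * (∫ x in fattening X h ε, b x * a x) -
      (ballVolume n ε)⁻¹ * ∫ x in fattening X h ε, χ x * (b x * a x)| ≤ η / 4 := by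
    have i2 := hint (fun x => χ x * b x) |C| (h1.continuousOn.mul hb) hbχ ε hε0
    simp only [mul_assoc (χ _) (b _) (a _)] at i2
    have i3 := hint (fun x => 1 - χ x) 1 h1c (hbd h401) ε hε0
    rw [← mul_sub, ← integral_sub (hint b C hb hbC ε hε0) i2, abs_mul, abs_of_nonneg (hv ε), ← hδ',
      ← Real.norm_eq_abs (integral _ _)]
    calc _ ≤ (ballVolume n ε)⁻¹ * ∫ x in fattening X h ε, (|C| + 1) * ((1 - χ x) * a x) := by
          refine mul_le_mul_of_nonneg_left ?_ (hv ε)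
          refine norm_integral_le_of_norm_le (i3.const_mul _) ?_
          filter_upwards [ae_restrict_mem (hfm ε)] with x hx
          exact hpt x hx.1
      _ = (|C| + 1) * ((ballVolume n ε)⁻¹ * ∫ x in fattening X h ε, (1 - χ x) * a x) := by
          rw [integral_const_mul]; ring
      _ ≤ _ := mul_le_mul_of_nonneg_left hε hC.le
  rw [Real.dist_eq] at hεT ⊢
  rw [abs_lt] at hεT ⊢
  rw [abs_le] at hclose hlim0
  constructor <;> linarith [hεT.1, hεT.2, hclose.1, hclose.2, hlim0.1, hlim0.2]

end

/-! ### The limit mass and weak convergence -/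

lemma limitMass_eq {d n : ℕ} {X : Set (EuclideanSpace ℝ (Fin d))} (hX : IsOpen X)
    {h : EuclideanSpace ℝ (Fin d) → EuclideanSpace ℝ (Fin n)} (hh : ContinuousOn h X)
    (a : EuclideanSpace ℝ (Fin d) → ℝ) :
    ∫⁻ x, ENNReal.ofReal (a x * coareaWeight h x) ∂(riemannianMeasure (d - n) (levelSet X h)) =
      limitMass X h a := by
  rw [limitMass, riemannianMeasure_restrict_levelSet _ hX hh]
  rfl

lemma limitMass_pos {d n : ℕ} {X : Set (EuclideanSpace ℝ (Fin d))} (hX : IsOpen X)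
    {h : EuclideanSpace ℝ (Fin d) → EuclideanSpace ℝ (Fin n)} (h_smooth : ContDiffOn ℝ 2 h X)
    (h_submersion : ∀ x ∈ X, Function.Surjective (fderiv ℝ h x))
    {a : EuclideanSpace ℝ (Fin d) → ℝ} (a_nonneg : ∀ x ∈ X, 0 ≤ a x) (a_cont : ContinuousOn a X)
    (a_supp : 0 < riemannianMeasure (d - n) (levelSet X h) (Function.support a ∩ levelSet X h)) :
    0 < limitMass X h a := by
  rw [← limitMass_eq hX h_smooth.continuousOn, pos_iff_ne_zero]
  intro h0
  rw [lintegral_eq_zero_iff' (aemeasurable_riemannianMeasure _ hX h_smooth.continuousOn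
    (c := fun x => a x * coareaWeight h x)
    (a_cont.mul (continuousOn_coareaWeight hX h_smooth h_submersion))).ennreal_ofReal] at h0
  refine a_supp.ne' (measure_mono_null ?_ (ae_iff.1 h0))
  intro x hx hx0
  have h1 : 0 < a x * coareaWeight h x :=
    mul_pos (lt_of_le_of_ne (a_nonneg x hx.2.1) (Ne.symm hx.1))
      (coareaWeight_pos (h_submersion x hx.2.1))
  exact absurd hx0 (ENNReal.ofReal_pos.2 h1).ne'

theorem theorem1 {d n : ℕ} (hdn : n < d)
    (X : Set (EuclideanSpace ℝ (Fin d))) (hX : IsOpen X)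
    (h : EuclideanSpace ℝ (Fin d) → EuclideanSpace ℝ (Fin n))
    (a : EuclideanSpace ℝ (Fin d) → ℝ)
    (h_smooth : ContDiffOn ℝ 2 h X)
    (h_submersion : ∀ x ∈ X, Function.Surjective (fderiv ℝ h x))
    (a_nonneg : ∀ x ∈ X, 0 ≤ a x)
    (a_cont : ContinuousOn a X)
    (a_supp : 0 < riemannianMeasure (d - n) (levelSet X h) (Function.support a ∩ levelSet X h))
    (a_mass : ∀ ε : ℝ, 0 < ε → 0 < fatteningMass X h a ε ∧ fatteningMass X h a ε < ∞)
    (tight : IsTightMeasureSet {P : Measure X | ∃ ε : ℝ, 0 < ε ∧ P = truncatedLaw X h a ε}) :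
    (0 < limitMass X h a ∧ limitMass X h a < ∞) ∧
    (∀ ε : ℝ, 0 < ε → IsProbabilityMeasure (truncatedLaw X h a ε)) ∧
    IsProbabilityMeasure (limitLaw X h a) ∧
    limitLaw X h a {x : X | (x : EuclideanSpace ℝ (Fin d)) ∉ levelSet X h} = 0 ∧
    ∀ g : X →ᵇ ℝ,
      Tendsto (fun ε : ℝ => ∫ x, g x ∂(truncatedLaw X h a ε)) (𝓝[>] 0)
        (𝓝 (∫ x, g x ∂(limitLaw X h a))) := by
  have hh := h_smooth.continuousOn
  have σ : Fin d ≃ Fin (d - n) ⊕ Fin n :=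
    (finCongr (Nat.sub_add_cancel hdn.le).symm).trans finSumFinEquiv.symm
  have hw := continuousOn_coareaWeight hX h_smooth h_submersion
  have hfm := measurableSet_fattening hX hh
  have hfX : ∀ ε, ∀ᵐ x ∂(volume.restrict (fattening X h ε)), x ∈ X := fun ε =>
    (ae_restrict_mem (hfm ε)).mono fun x hx => hx.1
  have ha0 : ∀ ε, 0 ≤ᵐ[volume.restrict (fattening X h ε)] a := fun ε =>
    (hfX ε).mono fun x hx => a_nonneg x hx
  have ham : ∀ ε, AEMeasurable a (volume.restrict (fattening X h ε)) := fun ε =>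
    (a_cont.mono fun x hx => hx.1).aemeasurable (hfm ε)
  have hprob : ∀ ε : ℝ, 0 < ε → IsProbabilityMeasure (truncatedLaw X h a ε) := fun ε hε => by
    rw [truncatedLaw_eq hX hh a (a_mass ε hε).1.ne']
    exact isProbabilityMeasure_comap_withDensity hX.measurableSet (hfX ε) rfl
      (a_mass ε hε).1.ne' (a_mass ε hε).2.ne
  have hPint : ∀ ε : ℝ, 0 < ε → ∀ b : EuclideanSpace ℝ (Fin d) → ℝ,
      ∫ x : X, b x ∂(truncatedLaw X h a ε) = (∫ x in fattening X h ε, a x)⁻¹ *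
        ∫ x in fattening X h ε, b x * a x := fun ε hε b => by
    rw [truncatedLaw_eq hX hh a (a_mass ε hε).1.ne']
    exact integral_comap_withDensity hX.measurableSet (hfX ε) (ham ε) (ha0 ε) rfl b
  have ha_int : ∀ ε, 0 < ε → IntegrableOn a (fattening X h ε) := fun ε hε =>
    ⟨(ham ε).aestronglyMeasurable, (hasFiniteIntegral_iff_ofReal (ha0 ε)).2 (a_mass ε hε).2⟩
  have ha_pos : ∀ ε, 0 < ε → 0 < ∫ x in fattening X h ε, a x := fun ε hε => by
    rw [integral_eq_lintegral_of_nonneg_ae (ha0 ε) (ha_int ε hε).1]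
    exact ENNReal.toReal_pos (a_mass ε hε).1.ne' (a_mass ε hε).2.ne
  have htight : ∀ δ, 0 < δ → ∃ χ : EuclideanSpace ℝ (Fin d) → ℝ, Continuous χ ∧
      HasCompactSupport χ ∧ tsupport χ ⊆ X ∧ (∀ x, χ x ∈ Set.Icc (0 : ℝ) 1) ∧ ∀ ε, 0 < ε →
        ∫ x in fattening X h ε, (1 - χ x) * a x ≤ δ * ∫ x in fattening X h ε, a x := by
    intro δ hδ
    -- A cutoff equal to `1` on `K` satisfies `1 - χ ≤ 𝟙_{Kᶜ}`, so the bound on `P_ε(Kᶜ)`,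
    -- multiplied by the total mass, becomes a bound on integrals of `a`.
    obtain ⟨K, hK, hKP⟩ := isTightMeasureSet_iff_exists_isCompact_measure_compl_le.1 tight
      (ENNReal.ofReal δ) (ENNReal.ofReal_pos.2 hδ)
    obtain ⟨χ, h1, h2, h3, h4, h5⟩ := exists_cutoff (hK.image continuous_subtype_val) hX
      (by rintro _ ⟨x, -, rfl⟩; exact x.2)
    refine ⟨χ, h1, h2, h3, h5, fun ε hε => ?_⟩
    have := hprob ε hε
    have hPK : (truncatedLaw X h a ε).real Kᶜ ≤ δ :=
      ENNReal.toReal_le_of_le_ofReal hδ.le (hKP _ ⟨ε, hε, rfl⟩)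
    have hle : ∫ x : X, (1 - χ x) ∂(truncatedLaw X h a ε) ≤ δ := by
      refine le_trans ?_ hPK
      rw [← integral_indicator_one hK.measurableSet.compl]
      refine integral_mono ?_ ((integrable_const (1 : ℝ)).indicator hK.measurableSet.compl) ?_
      · refine (integrable_const (1 : ℝ)).mono' (by fun_prop) (ae_of_all _ fun x => ?_)
        rw [Real.norm_eq_abs, abs_le]
        constructor <;> linarith [(h5 x).1, (h5 x).2]
      · intro x
        by_cases hx : x ∈ K
        · simp [hx, h4 x ⟨x, hx, rfl⟩]
        · simpa [hx] using (h5 x).1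
    rw [hPint ε hε (fun x => 1 - χ x), inv_mul_le_iff₀ (ha_pos ε hε)] at hle
    linarith
  obtain ⟨haw, hlim⟩ := tendsto_fattening_integral_of_tight σ hX h_smooth h_submersion a_nonneg
    a_cont ha_int htight
  have hae := ae_mem_levelSet (d - n) hX hh
  have haw0 : 0 ≤ᵐ[riemannianMeasure (d - n) (levelSet X h)] fun x => a x * coareaWeight h x :=
    hae.mono fun x hx => mul_nonneg (a_nonneg x hx.1) (coareaWeight_pos (h_submersion x hx.1)).le
  have hpos := limitMass_pos hX h_smooth h_submersion a_nonneg a_cont a_supp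
  have hfin : limitMass X h a < ∞ := by
    rw [← limitMass_eq hX hh]
    exact (hasFiniteIntegral_iff_ofReal haw0).1 haw.2
  have hIpos : 0 < ∫ x, a x * coareaWeight h x ∂(riemannianMeasure (d - n) (levelSet X h)) := by
    rw [integral_eq_lintegral_of_nonneg_ae haw0 haw.1, limitMass_eq hX hh]
    exact ENNReal.toReal_pos hpos.ne' hfin.ne
  have haeX := hae.mono fun x hx => hx.1
  refine ⟨⟨hpos, hfin⟩, hprob, ?_, ?_, fun g => ?_⟩
  · rw [limitLaw_eq a hpos.ne']
    exact isProbabilityMeasure_comap_withDensity hX.measurableSet haeX (limitMass_eq hX hh a)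
      hpos.ne' hfin.ne
  · rw [limitLaw, (MeasurableEmbedding.subtype_coe hX.measurableSet).comap_apply]
    refine withDensity_absolutelyContinuous _ _ (measure_mono_null ?_ (ae_iff.1 hae))
    rintro _ ⟨x, hx, rfl⟩
    exact hx
  -- The extension by zero may be discontinuous at the boundary of `X`; only continuity on `X` is
  -- needed.
  · set b : EuclideanSpace ℝ (Fin d) → ℝ := Function.extend Subtype.val g 0 with hb
    have hbg : ∀ x : X, b x = g x := fun x => Subtype.val_injective.extend_apply g 0 x
    have hbc : ContinuousOn b X := by
      rw [continuousOn_iff_continuous_domRestrict]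
      exact g.continuous.congr fun x => (hbg x).symm
    have hbC : ∀ x ∈ X, |b x| ≤ ‖g‖ := fun x hx => by
      rw [hbg ⟨x, hx⟩]
      exact g.norm_coe_le_norm ⟨x, hx⟩
    have hL : ∫ x, g x ∂(limitLaw X h a) =
        (∫ x, a x * coareaWeight h x ∂(riemannianMeasure (d - n) (levelSet X h)))⁻¹ *
        ∫ x, b x * a x * coareaWeight h x ∂(riemannianMeasure (d - n) (levelSet X h)) := by
      simp_rw [← hbg, mul_assoc]
      rw [limitLaw_eq a hpos.ne']
      exact integral_comap_withDensity hX.measurableSet haeX haw.1.aemeasurable haw0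
        (limitMass_eq hX hh a) b
    have h1 := hlim (fun _ => 1) 1 continuousOn_const (by simp)
    simp only [one_mul] at h1
    rw [hL]
    -- The quotient of the formulas for `b * a` and `a`, in which the ball volumes cancel.
    refine ((h1.inv₀ hIpos.ne').mul (hlim b ‖g‖ hbc hbC)).congr' ?_
    filter_upwards [self_mem_nhdsWithin] with ε hε
    simp_rw [← hbg]
    rw [hPint ε hε b]
    have hv := (ballVolume_pos n hε).ne'
    have hp := (ha_pos ε hε).ne'
    field_simp
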